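/- Let $k\in\mathbb N$, let $A\in\mathbb R^{k\times k}$ be symmetric and positive definite, and let $A=V^{T}\operatorname{diag}(\lambda_1,\dots,\lambda_k)V$ with $V$ orthogonal, $\lambda_k=k$ and $\lambda_i<k$ for $i<k$. Let $N=N(n)$ be a strictly increasing sequence of positive integers, and for each $n$ let $\{1,\dots,N\}$ be partitioned into blocks $B_1^{(n)},\dots,B_k^{(n)}$ of asymptotically equal sizes in the sense that, for every $i$, $$\sqrt{N}\left(\frac{|B_i^{(n)}|}{N}-\frac1k\right)\longrightarrow 0\qquad(n\to\infty)$$ (in particular this covers $|B_i^{(n)}|=N/k$, and $|B_i^{(n)}|=N/k+O(1)$). Let $\mu_{J_n}$ be the probability measure on $\{-1,+1\}^{N}$ with $\mu_{J_n}(x)=Z_n^{-1}\exp\big(\tfrac12\sum_{i,j=1}^N (J_n)_{ij}x_ix_j\big)$, where $(J_n)_{ij}=A_{pq}/N$ for $i\in B_p^{(n)}$, $j\in B_q^{(n)}$, and $Z_n$ is the normalizing constant. Put $m^{(n)}(x)=\big(\sum_{j\in B_i^{(n)}}x_j\big)_{i=1,\dots,k}$, $$w'_n=\operatorname{diag}(N^{-1/2},\dots,N^{-1/2},N^{-3/4})\,V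 m^{(n)},\qquad \hat C_N=\operatorname{diag}(\lambda_1,\dots,\lambda_{k-1},kN^{1/2}).$$ For each $n$ let $X_n\sim\mu_{J_n}$ and $Y_n\sim\mathcal N(0,\hat C_N^{-1})$ be independent random variables on a common probability space. Then: 1. $w'_n(X_n)+Y_n$ converges in distribution to a probability measure on $\mathbb R^k$ with Lebesgue density $$\tilde Z^{-1}\exp\left(-\frac12\sum_{i=1}^{k-1}\Big(\lambda_i-\frac{\lambda_i^2}{k}\Big)x_i^2-\frac{k^3}{12}\,x_k^4\sum_{i=1}^kV_{ki}^4\right)$$ for a normalizing constant $\tilde Z>0$. 2. The vector $(w'_n(X_n)_j)_{j=1,\dots,k-1}$ converges in distribution to the centered normal distribution with covariance matrix $\operatorname{diag}\big((k-\lambda_j)^{-1}\big)_{j=1,\dots,k-1}$. 3. $w'_n(X_n)_k$ converges in distribution to a probability measure on $\mathbb R$ with Lebesgue density $Z^{-1}\exp\big(-\big(\tfrac{k^3}{12}\sum_{i=1}^kV_{ki}^4\big)x^4\big)$ for a normalizing constant $Z>0$. -/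

import Mathlib

open MeasureTheory ProbabilityTheory Filter Topology Matrix

noncomputable section

namespace BlockIsing

/-! ### Ising measures on `{-1, +1}^ι` -/

/-- The real value `±1` of a spin; the spin space `{-1, +1}` is modelled by `ℤˣ`. -/
def spin (s : ℤˣ) : ℝ := ((s : ℤ) : ℝ)

/-- The Boltzmann weight `exp (½ ∑ i j, J i j * x i * x j)`. -/
def isingWeight {ι : Type*} [Fintype ι] (J : Matrix ι ι ℝ) (x : ι → ℤˣ) : ℝ :=
  Real.exp ((1 / 2) * ∑ i, ∑ j, J i j * spin (x i) * spin (x j))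

/-- The partition function. -/
def partitionFunction {ι : Type*} [Fintype ι] [DecidableEq ι] (J : Matrix ι ι ℝ) : ℝ :=
  ∑ x : ι → ℤˣ, isingWeight J x

/-- The Ising (Gibbs) probability measure on `{-1, +1}^ι` with interaction matrix `J`. -/
def isingMeasure {ι : Type*} [Fintype ι] [DecidableEq ι] (J : Matrix ι ι ℝ) :
    Measure (ι → ℤˣ) :=
  ∑ x : ι → ℤˣ, ENNReal.ofReal (isingWeight J x / partitionFunction J) • Measure.dirac x

/-! ### The block spin model

A partition of the sites `Fin N` into `k` labelled blocks is given by the map `b : Fin N → Fin k`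
which sends a site to the label of its block. -/

/-- The number of sites in block `i`. -/
def blockSize {N k : ℕ} (b : Fin N → Fin k) (i : Fin k) : ℕ :=
  (Finset.univ.filter fun j => b j = i).card

/-- The block interaction: the entry at two sites in blocks `p`, `q` is `A p q / N`. -/
def blockInteraction {N k : ℕ} (A : Matrix (Fin k) (Fin k) ℝ) (b : Fin N → Fin k) :
    Matrix (Fin N) (Fin N) ℝ :=
  Matrix.of fun i j => (1 / (N : ℝ)) * A (b i) (b j)

/-- The non-normalized vector of block magnetizations. -/
def blockMagnetization {N k : ℕ} (b : Fin N → Fin k) (x : Fin N → ℤˣ) : Fin k → ℝ :=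
  fun i => ∑ j with b j = i, spin (x j)

/-! ### The critical scaling, with `k = d + 1` blocks -/

/-- `diag (N^(-1/2), …, N^(-1/2), N^(-3/4)) V m`. -/
def rescaledMagnetization {N d : ℕ} (V : Matrix (Fin (d + 1)) (Fin (d + 1)) ℝ)
    (b : Fin N → Fin (d + 1)) (x : Fin N → ℤˣ) : EuclideanSpace ℝ (Fin (d + 1)) :=
  WithLp.toLp 2
    (Matrix.diagonal (fun i : Fin (d + 1) =>
        if i = Fin.last d then (N : ℝ) ^ (-(3 / 4) : ℝ) else (N : ℝ) ^ (-(1 / 2) : ℝ)) *ᵥ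
      (V *ᵥ blockMagnetization b x))

/-- `diag (lam 1, …, lam (k-1), k * N^(1/2))` with `k = d + 1`. -/
def scaledSpectrum {d : ℕ} (lam : Fin (d + 1) → ℝ) (N : ℕ) :
    Matrix (Fin (d + 1)) (Fin (d + 1)) ℝ :=
  Matrix.diagonal fun i =>
    if i = Fin.last d then ((d + 1 : ℕ) : ℝ) * (N : ℝ) ^ (1 / 2 : ℝ) else lam i

/-- The coefficient `(k^3 / 12) * ∑ i, (V k i)^4` with `k = d + 1`. -/
def quarticCoeff {d : ℕ} (V : Matrix (Fin (d + 1)) (Fin (d + 1)) ℝ) : ℝ :=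
  ((d + 1 : ℕ) : ℝ) ^ 3 / 12 * ∑ i, V (Fin.last d) i ^ 4

end BlockIsing

end

noncomputable section

namespace BlockIsing

/-! ### The logarithm of the hyperbolic cosine -/

/-! The interaction energy equals `½ ∑ c_i w_i²`, with `w` the rescaled magnetization and `c` the
diagonal of `Ĉ_N`. Adding an independent Gaussian with covariance `diag (1 / c_i)` therefore cancels
the squares of `w`: the law of `w + Y` is a mixture of exponentials linear in the spins, and summing
the spins out leaves a product of powers `cosh (u_p) ^ |B_p|` (`convolvedDensity_eq_sum`,
`sum_exp_blockMagnetization`). The field `u` is linear in `x`.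

Expand `log cosh u = u²/2 - u⁴/12 + …`. By orthogonality of `V`, the quadratic part cancels the
Gaussian exactly in the critical direction, where the eigenvalue is `k`, and turns `λ_i` into `λ_i -
λ_i²/k` elsewhere (`convolvedDensity_eq_exp`). Since `N^(1/4) u_p` tends to `k V_{kp} x_k`, the next
term gives the quartic, while the hypothesis on the block sizes removes their fluctuations
(`tendsto_convolvedDensity`). A Gaussian bound uniform in large `n`
(`convolvedDensity_le_dominatingDensity`) permits dominated convergence, hence convergence of the
characteristic functions of `w + Y`.

Dividing by the nonvanishing characteristic function of `Y` gives those of `w`. The noise has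
variance tending to `0` in the critical direction; in the others the variances subtract, `(λ -
λ²/k)⁻¹ - λ⁻¹ = (k - λ)⁻¹`. The marginals follow by setting Fourier variables to zero, and Lévy's
theorem concludes. -/

lemma hasDerivAt_log_cosh (u : ℝ) :
    HasDerivAt (fun x => Real.log (Real.cosh x)) (Real.tanh u) u := by
  rw [Real.tanh_eq_sinh_div_cosh]
  exact (Real.hasDerivAt_cosh u).log (Real.cosh_pos u).ne'

lemma hasDerivAt_tanh_one_sub_sq (u : ℝ) :
    HasDerivAt Real.tanh (1 - Real.tanh u ^ 2) u := by
  have h : Real.tanh = fun x => Real.sinh x / Real.cosh x :=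
    funext Real.tanh_eq_sinh_div_cosh
  have hc := (Real.cosh_pos u).ne'
  rw [h]
  refine ((Real.hasDerivAt_sinh u).fun_div (Real.hasDerivAt_cosh u) hc).congr_deriv ?_
  field_simp

/-- A function that starts with a larger value and grows faster is larger. -/
lemma le_of_hasDerivAt_le {f g f' g' : ℝ → ℝ} {a b : ℝ} (hab : a ≤ b)
    (hf : ∀ x, HasDerivAt f (f' x) x) (hg : ∀ x, HasDerivAt g (g' x) x) (h0 : f a ≤ g a)
    (h : ∀ x, a ≤ x → x < b → f' x ≤ g' x) : f b ≤ g b :=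
  image_le_of_deriv_right_le_deriv_boundary
    (fun x _ => (hf x).continuousAt.continuousWithinAt)
    (fun x _ => (hf x).hasDerivWithinAt) h0
    (fun x _ => (hg x).continuousAt.continuousWithinAt)
    (fun x _ => (hg x).hasDerivWithinAt) (fun x hx => h x hx.1 hx.2) ⟨hab, le_rfl⟩

lemma tanh_nonneg_of_nonneg {u : ℝ} (hu : 0 ≤ u) : 0 ≤ Real.tanh u := by
  rw [Real.tanh_eq_sinh_div_cosh]
  exact div_nonneg (Real.sinh_nonneg_iff.2 hu) (Real.cosh_pos u).le

lemma tanh_le_self_of_nonneg {u : ℝ} (hu : 0 ≤ u) : Real.tanh u ≤ u :=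
  le_of_hasDerivAt_le hu hasDerivAt_tanh_one_sub_sq (fun x => hasDerivAt_id x) (by simp)
    fun x _ _ => by nlinarith [sq_nonneg (Real.tanh x)]

/-- The equation `tanh' = 1 - tanh²` turns an upper bound on `tanh` into a lower bound by
integration, and conversely; the quintic bound is the next turn of this bootstrap. -/
lemma sub_cube_le_tanh {u : ℝ} (hu : 0 ≤ u) : u - u ^ 3 / 3 ≤ Real.tanh u := by
  refine le_of_hasDerivAt_le (f := fun x => x - x ^ 3 / 3) (f' := fun x => 1 - x ^ 2) hu
    (fun x => ?_) hasDerivAt_tanh_one_sub_sq (by simp) fun x hx _ => ?_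
  · refine ((hasDerivAt_id' x).fun_sub ((hasDerivAt_pow 3 x).div_const 3)).congr_deriv ?_
    norm_num
  · have := pow_le_pow_left₀ (tanh_nonneg_of_nonneg hx) (tanh_le_self_of_nonneg hx) 2
    linarith

lemma tanh_le_quintic {u : ℝ} (hu : 0 ≤ u) (hu1 : u ≤ 1) :
    Real.tanh u ≤ u - u ^ 3 / 3 + 2 * u ^ 5 / 15 := by
  refine le_of_hasDerivAt_le (g := fun x => x - x ^ 3 / 3 + 2 * x ^ 5 / 15)
    (g' := fun x => 1 - x ^ 2 + 2 / 3 * x ^ 4) hu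
    hasDerivAt_tanh_one_sub_sq (fun x => ?_) (by simp) fun x hx hxu => ?_
  · refine (((hasDerivAt_id' x).fun_sub ((hasDerivAt_pow 3 x).div_const 3)).fun_add
      (((hasDerivAt_pow 5 x).const_mul 2).div_const 15)).congr_deriv ?_
    norm_num
    ring
  · have hx1 : x ^ 2 ≤ 1 := by nlinarith
    -- Squaring the lower bound on `tanh` requires it to be nonnegative, hence the restriction to `x
    -- ≤ 1`.
    have h0 : 0 ≤ x - x ^ 3 / 3 := by nlinarith [mul_nonneg hx (sub_nonneg.2 hx1)]
    have := pow_le_pow_left₀ h0 (sub_cube_le_tanh hx) 2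
    nlinarith [sq_nonneg (x ^ 3)]

lemma log_cosh_nonneg (u : ℝ) : 0 ≤ Real.log (Real.cosh u) := Real.log_nonneg (Real.one_le_cosh u)

lemma log_cosh_le_half_sq (u : ℝ) : Real.log (Real.cosh u) ≤ u ^ 2 / 2 := by
  rw [Real.log_le_iff_le_exp (Real.cosh_pos u)]
  exact Real.cosh_le_exp_half_sq u

lemma log_cosh_abs (u : ℝ) : Real.log (Real.cosh |u|) = Real.log (Real.cosh u) := by
  rw [Real.cosh_abs]

lemma le_log_cosh (u : ℝ) : u ^ 2 / 2 - u ^ 4 / 12 ≤ Real.log (Real.cosh u) := by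
  have key : ∀ u : ℝ, 0 ≤ u → u ^ 2 / 2 - u ^ 4 / 12 ≤ Real.log (Real.cosh u) := by
    intro u hu
    refine le_of_hasDerivAt_le (f := fun x => x ^ 2 / 2 - x ^ 4 / 12)
      (f' := fun x => x - x ^ 3 / 3) hu (fun x => ?_) hasDerivAt_log_cosh (by simp)
      fun x hx _ => sub_cube_le_tanh hx
    refine (((hasDerivAt_pow 2 x).div_const 2).fun_sub
      ((hasDerivAt_pow 4 x).div_const 12)).congr_deriv ?_
    norm_num
    ring
  simpa [log_cosh_abs, (show Even 4 by decide).pow_abs] using key |u| (abs_nonneg u)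

lemma log_cosh_le_sextic {u : ℝ} (hu : |u| ≤ 1) :
    Real.log (Real.cosh u) ≤ u ^ 2 / 2 - u ^ 4 / 12 + u ^ 6 / 45 := by
  have key : ∀ u : ℝ, 0 ≤ u → u ≤ 1 →
      Real.log (Real.cosh u) ≤ u ^ 2 / 2 - u ^ 4 / 12 + u ^ 6 / 45 := by
    intro u hu hu1
    refine le_of_hasDerivAt_le (g := fun x => x ^ 2 / 2 - x ^ 4 / 12 + x ^ 6 / 45)
      (g' := fun x => x - x ^ 3 / 3 + 2 * x ^ 5 / 15) hu hasDerivAt_log_cosh (fun x => ?_)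
      (by simp) fun x hx hxu => tanh_le_quintic hx (hxu.le.trans hu1)
    refine ((((hasDerivAt_pow 2 x).div_const 2).fun_sub
      ((hasDerivAt_pow 4 x).div_const 12)).fun_add
      ((hasDerivAt_pow 6 x).div_const 45)).congr_deriv ?_
    norm_num
    ring
  simpa [log_cosh_abs, (show Even 4 by decide).pow_abs, (show Even 6 by decide).pow_abs]
    using key |u| (abs_nonneg u) hu

/-- Every parabola `θ u² - θ²` with `0 ≤ θ ≤ 1` bounds `u² / 2 - log (cosh u)` from below,
up to a constant factor. -/
lemma log_cosh_le_half_sq_sub {θ : ℝ} (h0 : 0 ≤ θ) (h1 : θ ≤ 1) (u : ℝ) :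
    Real.log (Real.cosh u) ≤ u ^ 2 / 2 - 1 / 20 * (θ * u ^ 2 - θ ^ 2) := by
  rcases le_or_gt |u| 1 with hu | hu
  · have h2 : u ^ 2 ≤ 1 := by rw [← sq_abs]; nlinarith [abs_nonneg u]
    have h6 : u ^ 6 ≤ u ^ 4 := by nlinarith [mul_nonneg (sq_nonneg (u ^ 2)) (sub_nonneg.2 h2)]
    -- The gain is at least `(1/12 - 1/45) u⁴ = 11/180 u⁴ ≥ u⁴/20`, and `u⁴ ≥ 2θu² - θ²`.
    nlinarith [log_cosh_le_sextic hu, sq_nonneg (u ^ 2 - θ), mul_nonneg h0 (sq_nonneg u)]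
  -- The sextic bound at `1` is `79/180 = 1 - 101/180`, and the slope is at most `1` afterwards. The
  -- square of `9/10 |u| - 1` below needs a constant of at least `5/9 = 100/180`.
  · have key : Real.log (Real.cosh |u|) ≤ |u| - 101 / 180 := by
      refine le_of_hasDerivAt_le (g := fun x => x - 101 / 180) (g' := fun _ => 1) hu.le
        hasDerivAt_log_cosh (fun x => (hasDerivAt_id x).sub_const _) ?_ fun x _ _ => ?_
      · have := log_cosh_le_sextic (u := 1) (by simp)
        norm_num at this ⊢
        linarith
      · rw [Real.tanh_eq_sinh_div_cosh, div_le_one (Real.cosh_pos x)]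
        exact (Real.sinh_lt_cosh x).le
    rw [log_cosh_abs] at key
    have : θ * u ^ 2 ≤ u ^ 2 := by nlinarith [sq_nonneg u]
    nlinarith [sq_abs u, sq_nonneg (9 / 10 * |u| - 1), sq_nonneg θ]

/-! ### Integrals against Ising measures -/

/-- With finitely many configurations, this makes every function of the spins measurable. -/
instance : MeasurableSingletonClass ℤˣ where
  measurableSet_singleton s :=
    ⟨{(s : ℤ)}, measurableSet_singleton _, by ext; simp [Units.ext_iff]⟩

lemma isingWeight_pos {ι : Type*} [Fintype ι] (J : Matrix ι ι ℝ) (x : ι → ℤˣ) :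
    0 < isingWeight J x := Real.exp_pos _

lemma partitionFunction_pos {ι : Type*} [Fintype ι] [DecidableEq ι] (J : Matrix ι ι ℝ) :
    0 < partitionFunction J :=
  Finset.sum_pos (fun x _ => isingWeight_pos J x) Finset.univ_nonempty

lemma integral_isingMeasure {ι : Type*} [Fintype ι] [DecidableEq ι] (J : Matrix ι ι ℝ)
    (f : (ι → ℤˣ) → ℂ) :
    ∫ x, f x ∂(isingMeasure J) = (∑ x, (isingWeight J x : ℂ) * f x) / partitionFunction J := by
  unfold isingMeasure
  rw [integral_finsetSum_measure fun x _ => (integrable_dirac (by simp)).smul_measure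
    ENNReal.ofReal_ne_top, Finset.sum_div]
  refine Finset.sum_congr rfl fun x _ => ?_
  rw [integral_smul_measure, integral_dirac, ENNReal.toReal_ofReal
    (div_nonneg (isingWeight_pos J x).le (partitionFunction_pos J).le), Complex.real_smul]
  push_cast
  ring

/-! ### Block sums -/

lemma sum_mul_blockMagnetization {N k : ℕ} (b : Fin N → Fin k) (x : Fin N → ℤˣ)
    (u : Fin k → ℝ) :
    ∑ p, u p * blockMagnetization b x p = ∑ j, u (b j) * spin (x j) := by
  rw [← Finset.sum_fiberwise Finset.univ b]
  refine Finset.sum_congr rfl fun p _ => ?_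
  rw [blockMagnetization, Finset.mul_sum]
  refine Finset.sum_congr rfl fun j hj => ?_
  rw [(Finset.mem_filter.1 hj).2]

/-- Summing out the spins against an external field that is constant on the blocks. -/
lemma sum_exp_blockMagnetization {N k : ℕ} (b : Fin N → Fin k) (u : Fin k → ℝ) :
    ∑ x : Fin N → ℤˣ, Real.exp (∑ p, u p * blockMagnetization b x p) =
      2 ^ N * ∏ p, Real.cosh (u p) ^ blockSize b p := by
  have hs : ∀ a : ℝ, ∑ s : ℤˣ, Real.exp (a * spin s) = 2 * Real.cosh a := by
    intro a
    rw [show (Finset.univ : Finset ℤˣ) = {1, -1} from rfl, Finset.sum_pair (by decide),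
      Real.cosh_eq]
    simp [spin]
    ring
  have hc : ∏ p, Real.cosh (u p) ^ blockSize b p = ∏ j, Real.cosh (u (b j)) := by
    rw [← Finset.prod_fiberwise Finset.univ b]
    refine Finset.prod_congr rfl fun p _ => ?_
    rw [Finset.prod_congr rfl fun j hj => by rw [(Finset.mem_filter.1 hj).2],
      Finset.prod_const, blockSize]
  simp_rw [sum_mul_blockMagnetization, Real.exp_sum]
  rw [hc, ← Fintype.piFinset_univ,
    ← Finset.prod_univ_sum (fun _ => Finset.univ) fun j s => Real.exp (u (b j) * spin s)]
  simp_rw [hs]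
  rw [Finset.prod_mul_distrib]
  simp

lemma isingWeight_blockInteraction {N k : ℕ} (A : Matrix (Fin k) (Fin k) ℝ)
    (b : Fin N → Fin k) (x : Fin N → ℤˣ) :
    isingWeight (blockInteraction A b) x =
      Real.exp (1 / 2 * (1 / N *
        (blockMagnetization b x ⬝ᵥ A *ᵥ blockMagnetization b x))) := by
  have h : blockMagnetization b x ⬝ᵥ A *ᵥ blockMagnetization b x =
      ∑ i, ∑ j, A (b i) (b j) * spin (x i) * spin (x j) := by
    rw [dotProduct_comm, dotProduct, sum_mul_blockMagnetization]
    refine Finset.sum_congr rfl fun i _ => ?_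
    rw [mulVec, dotProduct, sum_mul_blockMagnetization, Finset.sum_mul]
    exact Finset.sum_congr rfl fun j _ => by ring
  rw [isingWeight, h]
  congr 2
  rw [Finset.mul_sum]
  refine Finset.sum_congr rfl fun i _ => ?_
  rw [Finset.mul_sum]
  exact Finset.sum_congr rfl fun j _ => by simp [blockInteraction]; ring

/-! ### The scaling of the coordinates -/

/-- The scaling exponents: `N ^ (-3/4)` in the last coordinate, `N ^ (-1/2)` in the others. -/
def coordScale (d N : ℕ) (i : Fin (d + 1)) : ℝ :=
  if i = Fin.last d then (N : ℝ) ^ (-(3 / 4) : ℝ) else (N : ℝ) ^ (-(1 / 2) : ℝ)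

/-- The diagonal of `scaledSpectrum`. -/
def scaledEigenvalue {d : ℕ} (lam : Fin (d + 1) → ℝ) (N : ℕ) (i : Fin (d + 1)) : ℝ :=
  if i = Fin.last d then ((d + 1 : ℕ) : ℝ) * (N : ℝ) ^ (1 / 2 : ℝ) else lam i

lemma scaledSpectrum_eq {d : ℕ} (lam : Fin (d + 1) → ℝ) (N : ℕ) :
    scaledSpectrum lam N = Matrix.diagonal (scaledEigenvalue lam N) := rfl

lemma scaledEigenvalue_pos {d N : ℕ} {lam : Fin (d + 1) → ℝ} (hlam : ∀ i, 0 < lam i)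
    (hN : 0 < N) (i : Fin (d + 1)) : 0 < scaledEigenvalue lam N i := by
  unfold scaledEigenvalue
  split_ifs
  · have : (0 : ℝ) < N := by exact_mod_cast hN
    positivity
  · exact hlam i

/-- The factor `N^(1/2)` in the last eigenvalue compensates `(N^(-3/4))² = N^(-3/2)`, so all
coordinates carry the same power `N⁻¹` as the interaction. -/
lemma scaledEigenvalue_mul_coordScale_sq {d N : ℕ} {lam : Fin (d + 1) → ℝ}
    (hlast : lam (Fin.last d) = ((d + 1 : ℕ) : ℝ)) (hN : 0 < N) (i : Fin (d + 1)) :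
    scaledEigenvalue lam N i * coordScale d N i ^ 2 = lam i / N := by
  have hN' : (0 : ℝ) < N := by exact_mod_cast hN
  have hpow : ∀ a : ℝ, ((N : ℝ) ^ a) ^ 2 = (N : ℝ) ^ (a * 2) := fun a => by
    rw [← Real.rpow_natCast, ← Real.rpow_mul hN'.le, Nat.cast_ofNat]
  unfold scaledEigenvalue coordScale
  split_ifs with h
  · rw [h, hlast, mul_assoc, hpow, ← Real.rpow_add hN',
      show (1 / 2 + -(3 / 4) * 2 : ℝ) = -1 by norm_num, Real.rpow_neg_one, div_eq_mul_inv]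
  · rw [hpow, show (-(1 / 2) * 2 : ℝ) = -1 by norm_num, Real.rpow_neg_one, div_eq_mul_inv]

lemma rescaledMagnetization_apply {N d : ℕ} (V : Matrix (Fin (d + 1)) (Fin (d + 1)) ℝ)
    (b : Fin N → Fin (d + 1)) (x : Fin N → ℤˣ) (i : Fin (d + 1)) :
    rescaledMagnetization V b x i = coordScale d N i * (V *ᵥ blockMagnetization b x) i := by
  rw [rescaledMagnetization, PiLp.toLp_apply, Matrix.mulVec_diagonal, coordScale]

/-- The interaction energy is diagonal in the rescaled magnetization. -/
lemma isingWeight_eq_rescaled {N d : ℕ} {A V : Matrix (Fin (d + 1)) (Fin (d + 1)) ℝ}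
    {lam : Fin (d + 1) → ℝ} (hdec : A = Vᵀ * Matrix.diagonal lam * V)
    (hlast : lam (Fin.last d) = ((d + 1 : ℕ) : ℝ)) (hN : 0 < N)
    (b : Fin N → Fin (d + 1)) (x : Fin N → ℤˣ) :
    isingWeight (blockInteraction A b) x =
      Real.exp (1 / 2 * ∑ i, scaledEigenvalue lam N i * rescaledMagnetization V b x i ^ 2) := by
  rw [isingWeight_blockInteraction, hdec, ← Matrix.mulVec_mulVec, ← Matrix.mulVec_mulVec,
    Matrix.dotProduct_mulVec, Matrix.vecMul_transpose, dotProduct, Finset.mul_sum]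
  congr 2
  refine Finset.sum_congr rfl fun i _ => ?_
  rw [rescaledMagnetization_apply, Matrix.mulVec_diagonal, mul_pow,
    ← mul_assoc (scaledEigenvalue lam N i),
    scaledEigenvalue_mul_coordScale_sq hlast hN]
  ring

/-! ### The Hubbard–Stratonovich transform -/

/-- The field acting on the spins of the blocks in the Hubbard–Stratonovich transform. -/
def blockField {d : ℕ} (V : Matrix (Fin (d + 1)) (Fin (d + 1)) ℝ) (lam : Fin (d + 1) → ℝ)
    (N : ℕ) (x : Fin (d + 1) → ℝ) (p : Fin (d + 1)) : ℝ :=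
  ∑ i, V i p * (scaledEigenvalue lam N i * coordScale d N i * x i)

/-- The density, up to normalization, of the sum of the rescaled magnetization and an independent
Gaussian vector. -/
def convolvedDensity {N d : ℕ} (V : Matrix (Fin (d + 1)) (Fin (d + 1)) ℝ)
    (lam : Fin (d + 1) → ℝ) (b : Fin N → Fin (d + 1)) (x : Fin (d + 1) → ℝ) : ℝ :=
  Real.exp (-∑ i, scaledEigenvalue lam N i / 2 * x i ^ 2) *
    ∏ p, Real.cosh (blockField V lam N x p) ^ blockSize b p

lemma sum_blockField_mul {N d : ℕ} (V : Matrix (Fin (d + 1)) (Fin (d + 1)) ℝ)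
    (lam : Fin (d + 1) → ℝ) (b : Fin N → Fin (d + 1)) (σ : Fin N → ℤˣ) (x : Fin (d + 1) → ℝ) :
    ∑ p, blockField V lam N x p * blockMagnetization b σ p =
      ∑ i, scaledEigenvalue lam N i * rescaledMagnetization V b σ i * x i := by
  simp_rw [blockField, Finset.sum_mul, rescaledMagnetization_apply, mulVec, dotProduct,
    Finset.mul_sum, Finset.sum_mul]
  rw [Finset.sum_comm]
  exact Finset.sum_congr rfl fun i _ => Finset.sum_congr rfl fun p _ => by ring

/-- Each summand is a Boltzmann weight times a Gaussian centred at the rescaled magnetization `w`,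
since `½cw² - ½c(x - w)² = -½cx² + cwx`. -/
lemma convolvedDensity_eq_sum {N d : ℕ} (V : Matrix (Fin (d + 1)) (Fin (d + 1)) ℝ)
    (lam : Fin (d + 1) → ℝ) (b : Fin N → Fin (d + 1)) (x : Fin (d + 1) → ℝ) :
    convolvedDensity V lam b x = (2 ^ N)⁻¹ * ∑ σ : Fin N → ℤˣ,
      Real.exp (-∑ i, scaledEigenvalue lam N i / 2 * x i ^ 2 +
        ∑ i, scaledEigenvalue lam N i * rescaledMagnetization V b σ i * x i) := by
  simp_rw [Real.exp_add, ← Finset.mul_sum, ← sum_blockField_mul, sum_exp_blockMagnetization]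
  rw [convolvedDensity]
  field_simp

/-- Completing the square: `(cw + it)² / (2c) = ½cw² + itw - t²/(2c)`. The three terms become the
Boltzmann weight, the character at `w` and the Gaussian characteristic function. -/
lemma integral_cexp_gaussian_shift {ι : Type*} [Fintype ι] {c : ι → ℝ} (hc : ∀ i, 0 < c i)
    (w t : ι → ℝ) :
    ∫ x : ι → ℝ, Complex.exp (-∑ i, ((c i / 2 : ℝ) : ℂ) * (x i : ℂ) ^ 2 +
        ∑ i, ((c i * w i : ℝ) + t i * Complex.I) * (x i : ℂ)) =
      (∏ i, (Real.pi / ((c i / 2 : ℝ) : ℂ)) ^ (1 / 2 : ℂ)) *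
        (((Real.exp (1 / 2 * ∑ i, c i * w i ^ 2) : ℝ) : ℂ) *
          Complex.exp ((∑ i, t i * w i : ℝ) * Complex.I) *
          ((Real.exp (-∑ i, t i ^ 2 / (2 * c i)) : ℝ) : ℂ)) := by
  rw [GaussianFourier.integral_cexp_neg_sum_mul_add (fun i => by
    rw [Complex.ofReal_re]; exact half_pos (hc i)), Finset.prod_mul_distrib]
  congr 1
  rw [← Complex.exp_sum, Complex.ofReal_exp, Complex.ofReal_exp, ← Complex.exp_add,
    ← Complex.exp_add]
  congr 1
  push_cast
  rw [Finset.mul_sum, Finset.sum_mul, ← Finset.sum_neg_distrib, ← Finset.sum_add_distrib,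
    ← Finset.sum_add_distrib]
  refine Finset.sum_congr rfl fun i _ => ?_
  have : (c i : ℂ) ≠ 0 := by exact_mod_cast (hc i).ne'
  field_simp
  ring_nf
  rw [Complex.I_sq]
  ring

lemma integrable_cexp_gaussian_shift {ι : Type*} [Fintype ι] {c : ι → ℝ} (hc : ∀ i, 0 < c i)
    (w t : ι → ℝ) :
    Integrable fun x : ι → ℝ => Complex.exp (-∑ i, ((c i / 2 : ℝ) : ℂ) * (x i : ℂ) ^ 2 +
        ∑ i, ((c i * w i : ℝ) + t i * Complex.I) * (x i : ℂ)) :=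
  GaussianFourier.integrable_cexp_neg_sum_mul_add (fun i => by
    rw [Complex.ofReal_re]; exact half_pos (hc i)) _

lemma integral_cexp_mul_convolvedDensity {N d : ℕ}
    {A V : Matrix (Fin (d + 1)) (Fin (d + 1)) ℝ}
    {lam : Fin (d + 1) → ℝ} (hlam : ∀ i, 0 < lam i) (hdec : A = Vᵀ * Matrix.diagonal lam * V)
    (hlast : lam (Fin.last d) = ((d + 1 : ℕ) : ℝ)) (hN : 0 < N)
    (b : Fin N → Fin (d + 1)) (t : Fin (d + 1) → ℝ) :
    ∫ x : Fin (d + 1) → ℝ, Complex.exp ((∑ i, t i * x i : ℝ) * Complex.I) *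
        (convolvedDensity V lam b x : ℂ) =
      ((2 ^ N)⁻¹ * ∏ i, (Real.pi / ((scaledEigenvalue lam N i / 2 : ℝ) : ℂ)) ^ (1 / 2 : ℂ)) *
        (∑ σ, (isingWeight (blockInteraction A b) σ : ℂ) *
          Complex.exp ((∑ i, t i * rescaledMagnetization V b σ i : ℝ) * Complex.I)) *
        ((Real.exp (-∑ i, t i ^ 2 / (2 * scaledEigenvalue lam N i)) : ℝ) : ℂ) := by
  have hc := scaledEigenvalue_pos hlam hN
  have h : ∀ x : Fin (d + 1) → ℝ, Complex.exp ((∑ i, t i * x i : ℝ) * Complex.I) *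
        (convolvedDensity V lam b x : ℂ) = (2 ^ N)⁻¹ * ∑ σ : Fin N → ℤˣ,
      Complex.exp (-∑ i, ((scaledEigenvalue lam N i / 2 : ℝ) : ℂ) * (x i : ℂ) ^ 2 +
        ∑ i, ((scaledEigenvalue lam N i * rescaledMagnetization V b σ i : ℝ) + t i * Complex.I)
          * (x i : ℂ)) := by
    intro x
    rw [convolvedDensity_eq_sum]
    push_cast
    rw [mul_left_comm, Finset.mul_sum]
    congr 1
    refine Finset.sum_congr rfl fun σ _ => ?_
    rw [← Complex.exp_add]
    congr 1
    simp_rw [add_mul, Finset.sum_add_distrib, Finset.sum_mul]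
    rw [add_comm, add_assoc]
    congr 2
    exact Finset.sum_congr rfl fun i _ => by ring
  simp_rw [h]
  rw [integral_const_mul, integral_finsetSum _ fun σ _ => integrable_cexp_gaussian_shift hc _ t]
  simp_rw [integral_cexp_gaussian_shift hc, ← isingWeight_eq_rescaled hdec hlast hN]
  rw [← Finset.mul_sum, ← Finset.sum_mul]
  ring

/-- The characteristic function of the rescaled magnetization, in terms of the density of its
convolution with a Gaussian. -/
lemma charFun_map_rescaledMagnetization {N d : ℕ}
    {A V : Matrix (Fin (d + 1)) (Fin (d + 1)) ℝ}
    {lam : Fin (d + 1) → ℝ} (hlam : ∀ i, 0 < lam i) (hdec : A = Vᵀ * Matrix.diagonal lam * V)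
    (hlast : lam (Fin.last d) = ((d + 1 : ℕ) : ℝ)) (hN : 0 < N)
    (b : Fin N → Fin (d + 1)) (t : EuclideanSpace ℝ (Fin (d + 1))) :
    charFun ((isingMeasure (blockInteraction A b)).map (rescaledMagnetization V b)) t *
        ((Real.exp (-∑ i, t i ^ 2 / (2 * scaledEigenvalue lam N i)) : ℝ) : ℂ) *
        ((∫ x, convolvedDensity V lam b x : ℝ) : ℂ) =
      ∫ x : Fin (d + 1) → ℝ, Complex.exp ((∑ i, t i * x i : ℝ) * Complex.I) *
        (convolvedDensity V lam b x : ℂ) := by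
  have hZ : (partitionFunction (blockInteraction A b) : ℂ) ≠ 0 := by
    exact_mod_cast (partitionFunction_pos _).ne'
  -- At `t = 0` the formula gives the total mass, a constant times the partition function; the same
  -- constant occurs for every `t`.
  have h0 := integral_cexp_mul_convolvedDensity hlam hdec hlast hN b 0
  simp only [Pi.zero_apply, zero_mul, Finset.sum_const_zero, Complex.ofReal_zero,
    Complex.exp_zero, one_mul, mul_one, ne_eq, OfNat.ofNat_ne_zero, not_false_eq_true, zero_pow,
    zero_div, neg_zero, Real.exp_zero, Complex.ofReal_one] at h0
  rw [integral_cexp_mul_convolvedDensity hlam hdec hlast hN b, ← integral_complex_ofReal, h0,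
    charFun_apply, integral_map (measurable_of_countable _).aemeasurable (by fun_prop),
    integral_isingMeasure]
  simp_rw [PiLp.inner_apply]
  have hp : (∑ σ, (isingWeight (blockInteraction A b) σ : ℂ)) =
      partitionFunction (blockInteraction A b) := by
    rw [partitionFunction]; push_cast; rfl
  rw [hp]
  simp only [RCLike.inner_apply, conj_trivial]
  have h : ∀ S Z E K : ℂ, Z ≠ 0 → S / Z * E * (K * Z) = K * S * E := by
    intros
    field_simp
  exact h _ _ _ _ hZ

/-! ### The exponent of the convolved density -/

lemma coordScale_last {d N : ℕ} : coordScale d N (Fin.last d) = (N : ℝ) ^ (-(3 / 4) : ℝ) :=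
  if_pos rfl

lemma coordScale_castSucc {d N : ℕ} (i : Fin d) :
    coordScale d N i.castSucc = (N : ℝ) ^ (-(1 / 2) : ℝ) :=
  if_neg (Fin.castSucc_lt_last i).ne

lemma scaledEigenvalue_last {d N : ℕ} (lam : Fin (d + 1) → ℝ) :
    scaledEigenvalue lam N (Fin.last d) = ((d + 1 : ℕ) : ℝ) * √(N : ℝ) := by
  rw [Real.sqrt_eq_rpow]
  exact if_pos rfl

lemma scaledEigenvalue_castSucc {d N : ℕ} (lam : Fin (d + 1) → ℝ) (i : Fin d) :
    scaledEigenvalue lam N i.castSucc = lam i.castSucc :=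
  if_neg (Fin.castSucc_lt_last i).ne

/-- The field is `Vᵀ z` for a diagonal rescaling `z` of `x`, and `Vᵀ` preserves the Euclidean norm.
-/
lemma sum_blockField_sq {d N : ℕ} {V : Matrix (Fin (d + 1)) (Fin (d + 1)) ℝ}
    (hV : V ∈ Matrix.orthogonalGroup (Fin (d + 1)) ℝ) {lam : Fin (d + 1) → ℝ}
    (hlast : lam (Fin.last d) = ((d + 1 : ℕ) : ℝ)) (hN : 0 < N) (x : Fin (d + 1) → ℝ) :
    (N : ℝ) * ∑ p, blockField V lam N x p ^ 2 =
      ∑ i : Fin d, lam i.castSucc ^ 2 * x i.castSucc ^ 2 +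
        ((d + 1 : ℕ) : ℝ) ^ 2 * √(N : ℝ) * x (Fin.last d) ^ 2 := by
  have hN' : (0 : ℝ) < N := by exact_mod_cast hN
  set z : Fin (d + 1) → ℝ := fun i => scaledEigenvalue lam N i * coordScale d N i * x i with hz
  have hu : blockField V lam N x = Vᵀ *ᵥ z := by
    ext p
    simp [blockField, mulVec, dotProduct, hz]
  have h : ∑ p, blockField V lam N x p ^ 2 = z ⬝ᵥ z := by
    have hV' : V * Vᵀ = 1 := (Matrix.mem_orthogonalGroup_iff _ _).1 hV
    calc ∑ p, blockField V lam N x p ^ 2 = (Vᵀ *ᵥ z) ⬝ᵥ (Vᵀ *ᵥ z) := by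
          rw [hu, dotProduct]; exact Finset.sum_congr rfl fun p _ => sq _
      _ = z ⬝ᵥ z := by
          rw [Matrix.mulVec_transpose, ← Matrix.dotProduct_mulVec, Matrix.mulVec_vecMul, hV',
            Matrix.one_mulVec]
  have hz2 : ∀ i, (N : ℝ) * (z i * z i) = scaledEigenvalue lam N i * lam i * x i ^ 2 := by
    intro i
    have := scaledEigenvalue_mul_coordScale_sq hlast hN i
    calc (N : ℝ) * (z i * z i) = N * scaledEigenvalue lam N i *
          (scaledEigenvalue lam N i * coordScale d N i ^ 2) * x i ^ 2 := by rw [hz]; ring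
      _ = _ := by rw [this]; field_simp
  rw [h, dotProduct, Finset.mul_sum]
  simp_rw [hz2]
  rw [Fin.sum_univ_castSucc]
  simp_rw [scaledEigenvalue_castSucc, scaledEigenvalue_last, hlast]
  congr 1
  · exact Finset.sum_congr rfl fun i _ => by ring
  · ring

/-- The Gaussian part of the exponent is quadratic in the noncritical coordinates; what remains
are the fluctuation of the block sizes and the non-Gaussian part of `log cosh`. -/
lemma convolvedDensity_eq_exp {d N : ℕ} {V : Matrix (Fin (d + 1)) (Fin (d + 1)) ℝ}
    (hV : V ∈ Matrix.orthogonalGroup (Fin (d + 1)) ℝ) {lam : Fin (d + 1) → ℝ}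
    (hlast : lam (Fin.last d) = ((d + 1 : ℕ) : ℝ)) (hN : 0 < N)
    (b : Fin N → Fin (d + 1)) (x : Fin (d + 1) → ℝ) :
    convolvedDensity V lam b x = Real.exp (
      -(1 / 2) * ∑ i : Fin d,
        (lam i.castSucc - lam i.castSucc ^ 2 / ((d + 1 : ℕ) : ℝ)) * x i.castSucc ^ 2 +
      ∑ p, √(N : ℝ) * ((blockSize b p : ℝ) / N - 1 / ((d + 1 : ℕ) : ℝ)) *
        (√(N : ℝ) * Real.log (Real.cosh (blockField V lam N x p))) -
      1 / ((d + 1 : ℕ) : ℝ) * ∑ p, N * (blockField V lam N x p ^ 2 / 2 -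
        Real.log (Real.cosh (blockField V lam N x p)))) := by
  have hN' : (0 : ℝ) < N := by exact_mod_cast hN
  have hk : ((d + 1 : ℕ) : ℝ) ≠ 0 := by positivity
  have hsq := sum_blockField_sq hV hlast hN x
  generalize hkk : ((d + 1 : ℕ) : ℝ) = k at *
  generalize hu : blockField V lam N x = u at *
  have h1 : ∀ p, √(N : ℝ) * ((blockSize b p : ℝ) / N - 1 / k) *
        (√(N : ℝ) * Real.log (Real.cosh (u p))) =
      blockSize b p * Real.log (Real.cosh (u p)) - N / k * Real.log (Real.cosh (u p)) := by
    intro p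
    have := Real.mul_self_sqrt hN'.le
    calc _ = (√(N : ℝ) * √(N : ℝ)) * ((blockSize b p : ℝ) / N - 1 / k) *
        Real.log (Real.cosh (u p)) := by ring
      _ = _ := by rw [this]; field_simp
  have h2 : ∑ p, N * (u p ^ 2 / 2 - Real.log (Real.cosh (u p))) =
      (N * ∑ p, u p ^ 2) / 2 - N * ∑ p, Real.log (Real.cosh (u p)) := by
    rw [Finset.mul_sum, Finset.mul_sum, Finset.sum_div, ← Finset.sum_sub_distrib]
    exact Finset.sum_congr rfl fun p _ => by ring
  have h3 : ∑ i : Fin d, (lam i.castSucc - lam i.castSucc ^ 2 / k) * x i.castSucc ^ 2 =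
      ∑ i : Fin d, lam i.castSucc * x i.castSucc ^ 2 -
        (∑ i : Fin d, lam i.castSucc ^ 2 * x i.castSucc ^ 2) / k := by
    rw [Finset.sum_div, ← Finset.sum_sub_distrib]
    exact Finset.sum_congr rfl fun p _ => by ring
  have h4 : ∑ i : Fin d, lam i.castSucc / 2 * x i.castSucc ^ 2 =
      (∑ i : Fin d, lam i.castSucc * x i.castSucc ^ 2) / 2 := by
    rw [Finset.sum_div]
    exact Finset.sum_congr rfl fun p _ => by ring
  have h5 : ∏ p, Real.cosh (u p) ^ blockSize b p =
      Real.exp (∑ p, blockSize b p * Real.log (Real.cosh (u p))) := by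
    rw [Real.exp_sum]
    refine Finset.prod_congr rfl fun p _ => ?_
    rw [Real.exp_nat_mul, Real.exp_log (Real.cosh_pos _)]
  rw [convolvedDensity, hu, h5, ← Real.exp_add, Fin.sum_univ_castSucc]
  simp_rw [scaledEigenvalue_castSucc, scaledEigenvalue_last, hkk, h1]
  -- After `hsq`, the term `N/k · ∑ u²/2` contains `k √N x_k² / 2`, which cancels the Gaussian
  -- exponent of the last coordinate.
  rw [h2, hsq, h3, h4, Finset.sum_sub_distrib, ← Finset.mul_sum]
  congr 1
  field_simp
  ring

/-! ### The limit density and the dominating density -/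

/-- The limit of the convolved densities. -/
def limitDensity {d : ℕ} (V : Matrix (Fin (d + 1)) (Fin (d + 1)) ℝ) (lam : Fin (d + 1) → ℝ)
    (x : Fin (d + 1) → ℝ) : ℝ :=
  Real.exp (-(1 / 2) * ∑ i : Fin d,
      (lam i.castSucc - lam i.castSucc ^ 2 / ((d + 1 : ℕ) : ℝ)) * x i.castSucc ^ 2
    - quarticCoeff V * x (Fin.last d) ^ 4)

/-- A Gaussian density that eventually dominates the convolved densities. -/
def dominatingDensity {d : ℕ} (lam : Fin (d + 1) → ℝ) (x : Fin (d + 1) → ℝ) : ℝ :=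
  Real.exp (-(1 / 2) * ∑ i : Fin d,
      (lam i.castSucc - lam i.castSucc ^ 2 / ((d + 1 : ℕ) : ℝ)) * x i.castSucc ^ 2
    - ((d + 1 : ℕ) : ℝ) / 40 * x (Fin.last d) ^ 2 + 1 / 20)

lemma convolvedDensity_le_dominatingDensity {d N : ℕ}
    {V : Matrix (Fin (d + 1)) (Fin (d + 1)) ℝ}
    (hV : V ∈ Matrix.orthogonalGroup (Fin (d + 1)) ℝ) {lam : Fin (d + 1) → ℝ}
    (hlast : lam (Fin.last d) = ((d + 1 : ℕ) : ℝ)) (hN : 0 < N)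
    (b : Fin N → Fin (d + 1))
    (hb : ∀ p, √(N : ℝ) * ((blockSize b p : ℝ) / N - 1 / ((d + 1 : ℕ) : ℝ)) ≤
      1 / (20 * ((d + 1 : ℕ) : ℝ))) (x : Fin (d + 1) → ℝ) :
    convolvedDensity V lam b x ≤ dominatingDensity lam x := by
  have hN' : (0 : ℝ) < N := by exact_mod_cast hN
  have hs : 0 < √(N : ℝ) := Real.sqrt_pos.2 hN'
  have hs1 : 1 ≤ √(N : ℝ) := Real.one_le_sqrt.2 (by exact_mod_cast hN)
  have hss : √(N : ℝ) * √(N : ℝ) = N := Real.mul_self_sqrt hN'.le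
  have hk : (0 : ℝ) < ((d + 1 : ℕ) : ℝ) := by positivity
  have hsq := sum_blockField_sq hV hlast hN x
  rw [convolvedDensity_eq_exp hV hlast hN, dominatingDensity]
  have hcard : ∑ _p : Fin (d + 1), (1 : ℝ) = ((d + 1 : ℕ) : ℝ) := by simp
  generalize ((d + 1 : ℕ) : ℝ) = k at *
  generalize blockField V lam N x = u at *
  generalize √(N : ℝ) = s at *
  have hquad : k ^ 2 * x (Fin.last d) ^ 2 ≤ s * ∑ p, u p ^ 2 := by
    have : 0 ≤ ∑ i : Fin d, lam i.castSucc ^ 2 * x i.castSucc ^ 2 :=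
      Finset.sum_nonneg fun i _ => by positivity
    rw [← hss] at hsq
    refine le_of_mul_le_mul_left ?_ hs
    nlinarith
  -- The threshold `1 / (20k)` is chosen so that the block size fluctuations use up only half of the
  -- quadratic gain in `h5`. A one-sided bound suffices because `log cosh` is nonnegative.
  have h1 : ∑ p, s * ((blockSize b p : ℝ) / N - 1 / k) * (s * Real.log (Real.cosh (u p))) ≤
      1 / (40 * k) * (s * ∑ p, u p ^ 2) := by
    rw [Finset.mul_sum, Finset.mul_sum]
    refine Finset.sum_le_sum fun p _ => ?_
    calc _ ≤ 1 / (20 * k) * (s * (u p ^ 2 / 2)) :=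
          mul_le_mul (hb p) (mul_le_mul_of_nonneg_left (log_cosh_le_half_sq _) hs.le)
            (mul_nonneg hs.le (log_cosh_nonneg _)) (by positivity)
      _ = _ := by field_simp; ring
  have h2 : 1 / 20 * (s * ∑ p, u p ^ 2) - 1 / 20 * k ≤
      ∑ p, N * (u p ^ 2 / 2 - Real.log (Real.cosh (u p))) := by
    rw [← hcard, Finset.mul_sum, Finset.mul_sum, Finset.mul_sum, ← Finset.sum_sub_distrib]
    refine Finset.sum_le_sum fun p _ => ?_
    -- With `θ = N^(-1/2)`, multiplication by `N` gives `(√N u² - 1) / 20`, the scale of `x_k²`.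
    have := log_cosh_le_half_sq_sub (inv_nonneg.2 hs.le) (inv_le_one_of_one_le₀ hs1) (u p)
    calc _ = N * (1 / 20 * (s⁻¹ * u p ^ 2 - s⁻¹ ^ 2)) := by rw [← hss]; field_simp
      _ ≤ _ := mul_le_mul_of_nonneg_left (by linarith) hN'.le
  have h3 : 1 / k * (1 / 20 * (s * ∑ p, u p ^ 2) - 1 / 20 * k) ≤
      1 / k * ∑ p, N * (u p ^ 2 / 2 - Real.log (Real.cosh (u p))) := by gcongr
  have h4 : k / 40 * x (Fin.last d) ^ 2 ≤ 1 / (40 * k) * (s * ∑ p, u p ^ 2) := by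
    calc _ = 1 / (40 * k) * (k ^ 2 * x (Fin.last d) ^ 2) := by field_simp
      _ ≤ _ := by gcongr
  have h5 : 1 / k * (1 / 20 * (s * ∑ p, u p ^ 2) - 1 / 20 * k) =
      2 * (1 / (40 * k) * (s * ∑ p, u p ^ 2)) - 1 / 20 := by field_simp; ring
  rw [Real.exp_le_exp]
  linarith

/-! ### Pointwise convergence -/

/-- Squeeze between the quartic and sextic bounds: `s⁴u⁶ = (su)⁴u²` vanishes because `u` tends to
`0`. -/
lemma tendsto_mul_log_cosh_remainder {s u : ℕ → ℝ} {y : ℝ} (hs : Tendsto s atTop atTop)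
    (hu : Tendsto (fun n => s n * u n) atTop (𝓝 y)) :
    Tendsto (fun n => s n ^ 4 * (u n ^ 2 / 2 - Real.log (Real.cosh (u n)))) atTop
      (𝓝 (y ^ 4 / 12)) := by
  have hu0 : Tendsto u atTop (𝓝 0) := by
    have := hs.inv_tendsto_atTop.mul hu
    rw [zero_mul] at this
    refine this.congr' ?_
    filter_upwards [hs.eventually_gt_atTop 0] with n hn
    simp [hn.ne']
  have hup : Tendsto (fun n => (s n * u n) ^ 4 / 12) atTop (𝓝 (y ^ 4 / 12)) :=
    (hu.pow 4).div_const 12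
  have hlow : Tendsto (fun n => (s n * u n) ^ 4 / 12 - (s n * u n) ^ 4 * u n ^ 2 / 45) atTop
      (𝓝 (y ^ 4 / 12)) := by
    simpa using hup.sub (((hu.pow 4).mul (hu0.pow 2)).div_const 45)
  refine tendsto_of_tendsto_of_tendsto_of_le_of_le' hlow hup ?_ (Eventually.of_forall fun n => ?_)
  · have : ∀ᶠ n in atTop, |u n| ≤ 1 := by
      have := hu0.abs.eventually_lt_const (u := 1) (by simp)
      exact this.mono fun _ h => h.le
    filter_upwards [this] with n hn
    have h4 : 0 ≤ s n ^ 4 := by positivity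
    have := mul_le_mul_of_nonneg_left (log_cosh_le_sextic hn) h4
    nlinarith
  · have h4 : 0 ≤ s n ^ 4 := by positivity
    have := mul_le_mul_of_nonneg_left (le_log_cosh (u n)) h4
    nlinarith

lemma tendsto_mul_log_cosh_zero {s u ε : ℕ → ℝ} {y : ℝ}
    (hu : Tendsto (fun n => s n * u n) atTop (𝓝 y)) (hε : Tendsto ε atTop (𝓝 0)) :
    Tendsto (fun n => ε n * (s n ^ 2 * Real.log (Real.cosh (u n)))) atTop (𝓝 0) := by
  have h := (hε.abs.mul ((hu.pow 2).div_const 2))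
  rw [abs_zero, zero_mul] at h
  refine squeeze_zero_norm (fun n => ?_) h
  rw [Real.norm_eq_abs, abs_mul, abs_of_nonneg (mul_nonneg (sq_nonneg _) (log_cosh_nonneg _))]
  gcongr
  have := mul_le_mul_of_nonneg_left (log_cosh_le_half_sq (u n)) (sq_nonneg (s n))
  nlinarith

/-- Only the critical coordinate survives: its exponents sum to `1/4 + 1/2 - 3/4 = 0`, those of the
others to `1/4 - 1/2 < 0`. -/
lemma tendsto_rpow_mul_blockField {d : ℕ} (V : Matrix (Fin (d + 1)) (Fin (d + 1)) ℝ)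
    (lam : Fin (d + 1) → ℝ) {N : ℕ → ℕ} (hN : Tendsto N atTop atTop) (hNpos : ∀ n, 0 < N n)
    (x : Fin (d + 1) → ℝ) (p : Fin (d + 1)) :
    Tendsto (fun n => (N n : ℝ) ^ (1 / 4 : ℝ) * blockField V lam (N n) x p) atTop
      (𝓝 (V (Fin.last d) p * (((d + 1 : ℕ) : ℝ) * x (Fin.last d)))) := by
  have hlow : ∀ i : Fin d, Tendsto (fun n => (N n : ℝ) ^ (1 / 4 : ℝ) *
      (V i.castSucc p * (scaledEigenvalue lam (N n) i.castSucc *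
        coordScale d (N n) i.castSucc * x i.castSucc))) atTop (𝓝 0) := by
    intro i
    have h : Tendsto (fun n => (N n : ℝ) ^ (-(1 / 4) : ℝ) *
        (V i.castSucc p * (lam i.castSucc * x i.castSucc))) atTop (𝓝 0) := by
      have := (tendsto_rpow_neg_atTop (show (0 : ℝ) < 1 / 4 by norm_num)).comp
        (tendsto_natCast_atTop_atTop.comp hN)
      simpa using this.mul_const (V i.castSucc p * (lam i.castSucc * x i.castSucc))
    refine h.congr fun n => ?_
    have hn : (0 : ℝ) < N n := by exact_mod_cast hNpos n
    rw [scaledEigenvalue_castSucc, coordScale_castSucc,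
      show (-(1 / 4) : ℝ) = 1 / 4 + -(1 / 2) by norm_num, Real.rpow_add hn]
    ring
  have hhigh : ∀ n, (N n : ℝ) ^ (1 / 4 : ℝ) *
      (V (Fin.last d) p * (scaledEigenvalue lam (N n) (Fin.last d) *
        coordScale d (N n) (Fin.last d) * x (Fin.last d))) =
      V (Fin.last d) p * (((d + 1 : ℕ) : ℝ) * x (Fin.last d)) := by
    intro n
    have hn : (0 : ℝ) < N n := by exact_mod_cast hNpos n
    have h1 : (N n : ℝ) ^ (1 / 4 : ℝ) * (N n : ℝ) ^ (1 / 2 : ℝ) *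
        (N n : ℝ) ^ (-(3 / 4) : ℝ) = 1 := by
      rw [← Real.rpow_add hn, ← Real.rpow_add hn]
      norm_num
    rw [scaledEigenvalue_last, coordScale_last, Real.sqrt_eq_rpow]
    linear_combination V (Fin.last d) p * (((d + 1 : ℕ) : ℝ) * x (Fin.last d)) * h1
  simp_rw [blockField, Fin.sum_univ_castSucc, mul_add, hhigh, Finset.mul_sum]
  have := (tendsto_finsetSum Finset.univ fun i _ => hlow i).add_const
    (V (Fin.last d) p * (((d + 1 : ℕ) : ℝ) * x (Fin.last d)))
  simpa using this

lemma tendsto_convolvedDensity {d : ℕ} {V : Matrix (Fin (d + 1)) (Fin (d + 1)) ℝ}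
    (hV : V ∈ Matrix.orthogonalGroup (Fin (d + 1)) ℝ) {lam : Fin (d + 1) → ℝ}
    (hlast : lam (Fin.last d) = ((d + 1 : ℕ) : ℝ))
    {N : ℕ → ℕ} (hN : Tendsto N atTop atTop) (hNpos : ∀ n, 0 < N n)
    (b : (n : ℕ) → Fin (N n) → Fin (d + 1))
    (hunif : ∀ i, Tendsto (fun n => √(N n : ℝ) *
      ((blockSize (b n) i : ℝ) / (N n : ℝ) - 1 / ((d + 1 : ℕ) : ℝ))) atTop (𝓝 0))
    (x : Fin (d + 1) → ℝ) :
    Tendsto (fun n => convolvedDensity V lam (b n) x) atTop (𝓝 (limitDensity V lam x)) := by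
  have hs : Tendsto (fun n => (N n : ℝ) ^ (1 / 4 : ℝ)) atTop atTop :=
    (tendsto_rpow_atTop (by norm_num)).comp (tendsto_natCast_atTop_atTop.comp hN)
  have hs2 : ∀ n, ((N n : ℝ) ^ (1 / 4 : ℝ)) ^ 2 = √(N n : ℝ) := fun n => by
    rw [← Real.rpow_natCast, ← Real.rpow_mul (Nat.cast_nonneg _), Real.sqrt_eq_rpow]
    norm_num
  have hs4 : ∀ n, ((N n : ℝ) ^ (1 / 4 : ℝ)) ^ 4 = N n := fun n => by
    rw [← Real.rpow_natCast, ← Real.rpow_mul (Nat.cast_nonneg _)]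
    norm_num
  have hu := tendsto_rpow_mul_blockField V lam hN hNpos x
  have h2 := tendsto_finsetSum Finset.univ fun p _ => tendsto_mul_log_cosh_zero (hu p) (hunif p)
  have h3 := tendsto_finsetSum Finset.univ fun p _ => tendsto_mul_log_cosh_remainder hs (hu p)
  simp_rw [hs2] at h2
  simp_rw [hs4] at h3
  simp_rw [convolvedDensity_eq_exp hV hlast (hNpos _)]
  refine (Real.continuous_exp.tendsto _).comp ?_
  -- The quartic coefficient arises as `1/k · (k V_{kp})⁴ / 12 = k³ V_{kp}⁴ / 12`, summed over `p`.
  convert (h2.const_add _).sub (h3.const_mul (1 / ((d + 1 : ℕ) : ℝ))) using 2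
  have hk : ((d + 1 : ℕ) : ℝ) ≠ 0 := by positivity
  simp only [Finset.sum_const_zero, add_zero, quarticCoeff, Finset.mul_sum, Finset.sum_mul]
  congr 1
  refine Finset.sum_congr rfl fun p _ => ?_
  field_simp

/-! ### Integrability -/

/-- A Gaussian dominates, as `x⁴ ≥ x² - 1/4`. -/
lemma integrable_exp_neg_mul_pow_four {q : ℝ} (hq : 0 < q) :
    Integrable fun x : ℝ => Real.exp (-q * x ^ 4) := by
  refine ((integrable_exp_neg_mul_sq hq).const_mul (Real.exp (q / 4))).mono'
    (by fun_prop) (Eventually.of_forall fun x => ?_)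
  rw [Real.norm_eq_abs, Real.abs_exp, ← Real.exp_add, Real.exp_le_exp]
  nlinarith [mul_nonneg hq.le (sq_nonneg (x ^ 2 - 1 / 2))]

/-- The exponential of a sum of functions of the single coordinates is a product. -/
lemma exp_sum_add_eq_prod {d : ℕ} (f : Fin d → ℝ → ℝ) (g : ℝ → ℝ) (x : Fin (d + 1) → ℝ) :
    Real.exp (∑ i, f i (x i.castSucc) + g (x (Fin.last d))) =
      ∏ i, Fin.lastCases (motive := fun _ => ℝ → ℝ) (fun y => Real.exp (g y))
        (fun j y => Real.exp (f j y)) i (x i) := by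
  rw [Fin.prod_univ_castSucc, Real.exp_add, Real.exp_sum]
  simp

lemma integrable_exp_sum_add {d : ℕ} {f : Fin d → ℝ → ℝ} {g : ℝ → ℝ}
    (hf : ∀ i, Integrable fun y => Real.exp (f i y)) (hg : Integrable fun y => Real.exp (g y)) :
    Integrable fun x : Fin (d + 1) → ℝ =>
      Real.exp (∑ i, f i (x i.castSucc) + g (x (Fin.last d))) := by
  simp_rw [exp_sum_add_eq_prod]
  refine Integrable.fintype_prod (μ := fun _ => volume) fun i => ?_
  induction i using Fin.lastCases with
  | last => simpa using hg
  | cast j => simpa using hf j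

lemma integral_cexp_mul_exp_sum_add {d : ℕ} (f : Fin d → ℝ → ℝ) (g : ℝ → ℝ)
    (t : Fin (d + 1) → ℝ) :
    ∫ x : Fin (d + 1) → ℝ, Complex.exp ((∑ i, t i * x i : ℝ) * Complex.I) *
        ((Real.exp (∑ i, f i (x i.castSucc) + g (x (Fin.last d))) : ℝ) : ℂ) =
      (∏ j : Fin d, ∫ y : ℝ, Complex.exp ((t j.castSucc * y : ℝ) * Complex.I) *
        ((Real.exp (f j y) : ℝ) : ℂ)) *
      ∫ y : ℝ, Complex.exp ((t (Fin.last d) * y : ℝ) * Complex.I) *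
        ((Real.exp (g y) : ℝ) : ℂ) := by
  have h : ∀ x : Fin (d + 1) → ℝ, Complex.exp ((∑ i, t i * x i : ℝ) * Complex.I) *
        ((Real.exp (∑ i, f i (x i.castSucc) + g (x (Fin.last d))) : ℝ) : ℂ) =
      ∏ i, (fun i y => Complex.exp ((t i * y : ℝ) * Complex.I) *
        ((Fin.lastCases (motive := fun _ => ℝ → ℝ) (fun y => Real.exp (g y))
        (fun j y => Real.exp (f j y)) i y : ℝ) : ℂ)) i (x i) := by
    intro x
    rw [exp_sum_add_eq_prod, Finset.prod_mul_distrib, ← Complex.exp_sum, Complex.ofReal_sum,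
      Finset.sum_mul, Complex.ofReal_prod]
  simp_rw [h]
  rw [integral_fintype_prod_volume_eq_prod (f := fun i y =>
    Complex.exp ((t i * y : ℝ) * Complex.I) *
        ((Fin.lastCases (motive := fun _ => ℝ → ℝ) (fun y => Real.exp (g y))
        (fun j y => Real.exp (f j y)) i y : ℝ) : ℂ)), Fin.prod_univ_castSucc]
  simp

lemma integral_cexp_mul_exp_neg_mul_sq {a : ℝ} (ha : 0 < a) (t : ℝ) :
    ∫ y : ℝ, Complex.exp ((t * y : ℝ) * Complex.I) * ((Real.exp (-(1 / 2) * (a * y ^ 2)) : ℝ) : ℂ) =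
      ((Real.exp (-(t ^ 2 / (2 * a))) : ℝ) : ℂ) *
        ((∫ y : ℝ, Real.exp (-(1 / 2) * (a * y ^ 2)) : ℝ) : ℂ) := by
  have ha' : 0 < ((a / 2 : ℝ) : ℂ).re := by rw [Complex.ofReal_re]; exact half_pos ha
  have h : ∀ t : ℝ, ∫ y : ℝ, Complex.exp ((t * y : ℝ) * Complex.I) *
      ((Real.exp (-(1 / 2) * (a * y ^ 2)) : ℝ) : ℂ) =
      (Real.pi / ((a / 2 : ℝ) : ℂ)) ^ (1 / 2 : ℂ) *
        Complex.exp (-(t : ℂ) ^ 2 / (4 * ((a / 2 : ℝ) : ℂ))) := by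
    intro t
    rw [← fourierIntegral_gaussian ha' t]
    congr 1 with y
    push_cast
    congr 2 <;> ring
  have h0 := h 0
  simp only [zero_mul, Complex.ofReal_zero, Complex.exp_zero, one_mul, ne_eq, OfNat.ofNat_ne_zero,
    not_false_eq_true, zero_pow, neg_zero, zero_div, mul_one] at h0
  rw [h t, ← integral_complex_ofReal, h0, mul_comm]
  congr 1
  push_cast
  congr 1
  ring

section limit

variable {d : ℕ} {V : Matrix (Fin (d + 1)) (Fin (d + 1)) ℝ} {lam : Fin (d + 1) → ℝ}

/-- The last row of `V` is a unit vector, so one of its entries is nonzero. -/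
lemma quarticCoeff_pos (hV : V ∈ Matrix.orthogonalGroup (Fin (d + 1)) ℝ) :
    0 < quarticCoeff V := by
  have hV' : V * Vᵀ = 1 := (Matrix.mem_orthogonalGroup_iff _ _).1 hV
  have h1 : ∑ p, V (Fin.last d) p * V (Fin.last d) p = 1 := by
    have := congrFun (congrFun hV' (Fin.last d)) (Fin.last d)
    simpa [Matrix.mul_apply] using this
  obtain ⟨p, -, hp⟩ := Finset.exists_ne_zero_of_sum_ne_zero (h1.trans_ne one_ne_zero)
  have hp' : V (Fin.last d) p ≠ 0 := left_ne_zero_of_mul hp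
  refine mul_pos (by positivity) (Finset.sum_pos' (fun i _ => by positivity)
    ⟨p, Finset.mem_univ _, by positivity⟩)

lemma sub_sq_div_pos (hlam : ∀ i, 0 < lam i)
    (hsimple : ∀ i : Fin d, lam i.castSucc < ((d + 1 : ℕ) : ℝ)) (i : Fin d) :
    0 < lam i.castSucc - lam i.castSucc ^ 2 / ((d + 1 : ℕ) : ℝ) := by
  have hk : (0 : ℝ) < ((d + 1 : ℕ) : ℝ) := by positivity
  rw [sub_pos, div_lt_iff₀ hk, sq]
  exact mul_lt_mul_of_pos_left (hsimple i) (hlam _)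

lemma integrable_exp_neg_half_mul_sq {a : ℝ} (ha : 0 < a) :
    Integrable fun y : ℝ => Real.exp (-(1 / 2) * (a * y ^ 2)) := by
  refine (integrable_exp_neg_mul_sq (half_pos ha)).congr (Eventually.of_forall fun y => ?_)
  ring_nf

lemma limitDensity_eq (x : Fin (d + 1) → ℝ) : limitDensity V lam x =
    Real.exp (∑ i : Fin d, (-(1 / 2) * ((lam i.castSucc - lam i.castSucc ^ 2 / ((d + 1 : ℕ) : ℝ)) *
      x i.castSucc ^ 2)) + -quarticCoeff V * x (Fin.last d) ^ 4) := by
  rw [limitDensity, Finset.mul_sum]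
  congr 1
  ring

lemma dominatingDensity_eq (x : Fin (d + 1) → ℝ) : dominatingDensity lam x =
    Real.exp (∑ i : Fin d, (-(1 / 2) * ((lam i.castSucc - lam i.castSucc ^ 2 / ((d + 1 : ℕ) : ℝ)) *
      x i.castSucc ^ 2)) +
      (-(((d + 1 : ℕ) : ℝ) / 40) * x (Fin.last d) ^ 2)) * Real.exp (1 / 20) := by
  rw [dominatingDensity, Finset.mul_sum, ← Real.exp_add]
  congr 1
  ring

lemma integrable_limitDensity (hV : V ∈ Matrix.orthogonalGroup (Fin (d + 1)) ℝ)
    (hlam : ∀ i, 0 < lam i) (hsimple : ∀ i : Fin d, lam i.castSucc < ((d + 1 : ℕ) : ℝ)) :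
    Integrable (limitDensity V lam) := by
  simp_rw [funext limitDensity_eq]
  exact integrable_exp_sum_add (f := fun i y => -(1 / 2) *
    ((lam i.castSucc - lam i.castSucc ^ 2 / ((d + 1 : ℕ) : ℝ)) * y ^ 2))
    (g := fun y => -quarticCoeff V * y ^ 4)
    (fun i => integrable_exp_neg_half_mul_sq (sub_sq_div_pos hlam hsimple i))
    (integrable_exp_neg_mul_pow_four (quarticCoeff_pos hV))

lemma integrable_dominatingDensity
    (hlam : ∀ i, 0 < lam i) (hsimple : ∀ i : Fin d, lam i.castSucc < ((d + 1 : ℕ) : ℝ)) :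
    Integrable (dominatingDensity lam) := by
  simp_rw [funext dominatingDensity_eq]
  exact (integrable_exp_sum_add (f := fun i y => -(1 / 2) *
    ((lam i.castSucc - lam i.castSucc ^ 2 / ((d + 1 : ℕ) : ℝ)) * y ^ 2))
    (g := fun y => -(((d + 1 : ℕ) : ℝ) / 40) * y ^ 2)
    (fun i => integrable_exp_neg_half_mul_sq (sub_sq_div_pos hlam hsimple i))
    (integrable_exp_neg_mul_sq (by positivity))).mul_const _

lemma continuous_convolvedDensity {N : ℕ} (V : Matrix (Fin (d + 1)) (Fin (d + 1)) ℝ)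
    (lam : Fin (d + 1) → ℝ) (b : Fin N → Fin (d + 1)) :
    Continuous (convolvedDensity V lam b) := by
  unfold convolvedDensity blockField
  fun_prop

lemma convolvedDensity_nonneg {N : ℕ} (V : Matrix (Fin (d + 1)) (Fin (d + 1)) ℝ)
    (lam : Fin (d + 1) → ℝ) (b : Fin N → Fin (d + 1)) (x : Fin (d + 1) → ℝ) :
    0 ≤ convolvedDensity V lam b x :=
  mul_nonneg (Real.exp_pos _).le (Finset.prod_nonneg fun _ _ => (pow_pos (Real.cosh_pos _) _).le)

lemma continuous_limitDensity : Continuous (limitDensity V lam) := by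
  unfold limitDensity
  fun_prop

lemma integral_limitDensity_pos (hV : V ∈ Matrix.orthogonalGroup (Fin (d + 1)) ℝ)
    (hlam : ∀ i, 0 < lam i) (hsimple : ∀ i : Fin d, lam i.castSucc < ((d + 1 : ℕ) : ℝ)) :
    0 < ∫ x, limitDensity V lam x :=
  integral_exp_pos (integrable_limitDensity hV hlam hsimple)

/-! ### Convergence of the characteristic functions -/

/-- The characteristic function of the density proportional to `exp (-q x ^ 4)`. -/
def quarticCharFun (q s : ℝ) : ℂ :=
  (∫ y : ℝ, Complex.exp ((s * y : ℝ) * Complex.I) * ((Real.exp (-q * y ^ 4) : ℝ) : ℂ)) /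
    ((∫ y : ℝ, Real.exp (-q * y ^ 4) : ℝ) : ℂ)

lemma quarticCharFun_zero {q : ℝ} (hq : 0 < q) : quarticCharFun q 0 = 1 := by
  have : (∫ y : ℝ, Real.exp (-q * y ^ 4)) ≠ 0 :=
    (integral_exp_pos (integrable_exp_neg_mul_pow_four hq)).ne'
  simp only [quarticCharFun, zero_mul, Complex.ofReal_zero, Complex.exp_zero, one_mul]
  rw [integral_complex_ofReal, div_self (by exact_mod_cast this)]

lemma integral_cexp_mul_limitDensity_div (hV : V ∈ Matrix.orthogonalGroup (Fin (d + 1)) ℝ)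
    (hlam : ∀ i, 0 < lam i) (hsimple : ∀ i : Fin d, lam i.castSucc < ((d + 1 : ℕ) : ℝ))
    (t : Fin (d + 1) → ℝ) :
    (∫ x : Fin (d + 1) → ℝ, Complex.exp ((∑ i, t i * x i : ℝ) * Complex.I) *
        (limitDensity V lam x : ℂ)) / ((∫ x, limitDensity V lam x : ℝ) : ℂ) =
      ((Real.exp (-∑ i : Fin d, t i.castSucc ^ 2 /
        (2 * (lam i.castSucc - lam i.castSucc ^ 2 / ((d + 1 : ℕ) : ℝ)))) : ℝ) : ℂ) *
        quarticCharFun (quarticCoeff V) (t (Fin.last d)) := by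
  have hq := quarticCoeff_pos hV
  let a : Fin d → ℝ := fun i => lam i.castSucc - lam i.castSucc ^ 2 / ((d + 1 : ℕ) : ℝ)
  have ha : ∀ i, 0 < a i := sub_sq_div_pos hlam hsimple
  let G : Fin d → ℂ := fun i => ((∫ y : ℝ, Real.exp (-(1 / 2) * (a i * y ^ 2)) : ℝ) : ℂ)
  have hG0 : ∏ i, G i ≠ 0 := Finset.prod_ne_zero_iff.2 fun i _ =>
    Complex.ofReal_ne_zero.2 (integral_exp_pos (integrable_exp_neg_half_mul_sq (ha i))).ne'
  have h : ∀ t : Fin (d + 1) → ℝ,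
      ∫ x : Fin (d + 1) → ℝ, Complex.exp ((∑ i, t i * x i : ℝ) * Complex.I) *
        (limitDensity V lam x : ℂ) =
      ((Real.exp (-∑ i : Fin d, t i.castSucc ^ 2 / (2 * a i)) : ℝ) : ℂ) * (∏ i, G i) *
      ∫ y : ℝ, Complex.exp ((t (Fin.last d) * y : ℝ) * Complex.I) *
        ((Real.exp (-quarticCoeff V * y ^ 4) : ℝ) : ℂ) := by
    intro t
    simp_rw [limitDensity_eq]
    rw [integral_cexp_mul_exp_sum_add (f := fun i y => -(1 / 2) * (a i * y ^ 2))
      (g := fun y => -quarticCoeff V * y ^ 4)]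
    rw [Finset.prod_congr rfl fun i _ => integral_cexp_mul_exp_neg_mul_sq (ha i) _,
      Finset.prod_mul_distrib, ← Complex.ofReal_prod, ← Real.exp_sum, Finset.sum_neg_distrib]
  have h0 := h 0
  simp only [Pi.zero_apply, zero_mul, Finset.sum_const_zero, Complex.ofReal_zero,
    Complex.exp_zero, one_mul, ne_eq, OfNat.ofNat_ne_zero, not_false_eq_true, zero_pow,
    zero_div, neg_zero, Real.exp_zero, Complex.ofReal_one] at h0
  rw [h t, ← integral_complex_ofReal, h0, quarticCharFun, integral_complex_ofReal]
  have halg : ∀ E P I J : ℂ, P ≠ 0 → E * P * I / (P * J) = E * (I / J) := by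
    intros
    field_simp
  exact halg _ _ _ _ hG0

variable {A : Matrix (Fin (d + 1)) (Fin (d + 1)) ℝ}

lemma tendsto_integral_mul_convolvedDensity
    (hV : V ∈ Matrix.orthogonalGroup (Fin (d + 1)) ℝ)
    (hlam : ∀ i, 0 < lam i) (hlast : lam (Fin.last d) = ((d + 1 : ℕ) : ℝ))
    (hsimple : ∀ i : Fin d, lam i.castSucc < ((d + 1 : ℕ) : ℝ))
    {N : ℕ → ℕ} (hN : Tendsto N atTop atTop) (hNpos : ∀ n, 0 < N n)
    (b : (n : ℕ) → Fin (N n) → Fin (d + 1))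
    (hunif : ∀ i, Tendsto (fun n => √(N n : ℝ) *
      ((blockSize (b n) i : ℝ) / (N n : ℝ) - 1 / ((d + 1 : ℕ) : ℝ))) atTop (𝓝 0))
    (t : Fin (d + 1) → ℝ) :
    Tendsto (fun n => ∫ x : Fin (d + 1) → ℝ, Complex.exp ((∑ i, t i * x i : ℝ) * Complex.I) *
        (convolvedDensity V lam (b n) x : ℂ)) atTop
      (𝓝 (∫ x : Fin (d + 1) → ℝ, Complex.exp ((∑ i, t i * x i : ℝ) * Complex.I) *
        (limitDensity V lam x : ℂ))) := by
  refine tendsto_integral_filter_of_dominated_convergence (dominatingDensity lam)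
    (Eventually.of_forall fun n => ?_) ?_ (integrable_dominatingDensity hlam hsimple)
    (Eventually.of_forall fun x => ?_)
  · have := continuous_convolvedDensity V lam (b n)
    exact Continuous.aestronglyMeasurable (by fun_prop)
  · have hev : ∀ᶠ n in atTop, ∀ p, √(N n : ℝ) * ((blockSize (b n) p : ℝ) / (N n : ℝ) -
        1 / ((d + 1 : ℕ) : ℝ)) ≤ 1 / (20 * ((d + 1 : ℕ) : ℝ)) :=
      eventually_all.2 fun p => ((hunif p).eventually_lt_const (by positivity)).mono
        fun _ h => h.le
    filter_upwards [hev] with n hn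
    refine Eventually.of_forall fun x => ?_
    rw [norm_mul, Complex.norm_exp_ofReal_mul_I, one_mul, Complex.norm_real, Real.norm_eq_abs,
      abs_of_nonneg (convolvedDensity_nonneg V lam (b n) x)]
    exact convolvedDensity_le_dominatingDensity hV hlast (hNpos n) (b n) hn x
  · exact ((Complex.continuous_ofReal.tendsto _).comp
      (tendsto_convolvedDensity hV hlast hN hNpos b hunif x)).const_mul _

/-- Convergence of the characteristic functions of the convolved vector. -/
lemma tendsto_charFun_rescaledMagnetization_mul
    (hV : V ∈ Matrix.orthogonalGroup (Fin (d + 1)) ℝ)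
    (hdec : A = Vᵀ * Matrix.diagonal lam * V)
    (hlam : ∀ i, 0 < lam i) (hlast : lam (Fin.last d) = ((d + 1 : ℕ) : ℝ))
    (hsimple : ∀ i : Fin d, lam i.castSucc < ((d + 1 : ℕ) : ℝ))
    {N : ℕ → ℕ} (hN : Tendsto N atTop atTop) (hNpos : ∀ n, 0 < N n)
    (b : (n : ℕ) → Fin (N n) → Fin (d + 1))
    (hunif : ∀ i, Tendsto (fun n => √(N n : ℝ) *
      ((blockSize (b n) i : ℝ) / (N n : ℝ) - 1 / ((d + 1 : ℕ) : ℝ))) atTop (𝓝 0))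
    (t : EuclideanSpace ℝ (Fin (d + 1))) :
    Tendsto (fun n => charFun ((isingMeasure (blockInteraction A (b n))).map
        (rescaledMagnetization V (b n))) t *
        ((Real.exp (-∑ i, t i ^ 2 / (2 * scaledEigenvalue lam (N n) i)) : ℝ) : ℂ)) atTop
      (𝓝 ((∫ x : Fin (d + 1) → ℝ, Complex.exp ((∑ i, t i * x i : ℝ) * Complex.I) *
        (limitDensity V lam x : ℂ)) / ((∫ x, limitDensity V lam x : ℝ) : ℂ))) := by
  have hZ : ((∫ x, limitDensity V lam x : ℝ) : ℂ) ≠ 0 := by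
    exact_mod_cast (integral_limitDensity_pos hV hlam hsimple).ne'
  have h := tendsto_integral_mul_convolvedDensity hV hlam hlast hsimple hN hNpos b hunif t
  have h0 := tendsto_integral_mul_convolvedDensity hV hlam hlast hsimple hN hNpos b hunif 0
  simp only [Pi.zero_apply, zero_mul, Finset.sum_const_zero, Complex.ofReal_zero,
    Complex.exp_zero, one_mul, integral_complex_ofReal] at h0
  refine (h.div h0 hZ).congr' ?_
  filter_upwards [h0.eventually_ne hZ] with n hn
  rw [Pi.div_apply, div_eq_iff hn, charFun_map_rescaledMagnetization hlam hdec hlast (hNpos n)]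

/-- The added noise degenerates in the critical direction, whose variance is of order `N^(-1/2)`. -/
lemma tendsto_sum_sq_div_scaledEigenvalue (lam : Fin (d + 1) → ℝ)
    {N : ℕ → ℕ} (hN : Tendsto N atTop atTop) (t : Fin (d + 1) → ℝ) :
    Tendsto (fun n => ∑ i, t i ^ 2 / (2 * scaledEigenvalue lam (N n) i)) atTop
      (𝓝 (∑ i : Fin d, t i.castSucc ^ 2 / (2 * lam i.castSucc))) := by
  simp_rw [Fin.sum_univ_castSucc, scaledEigenvalue_castSucc, scaledEigenvalue_last]
  have h : Tendsto (fun n => t (Fin.last d) ^ 2 / (2 * (((d + 1 : ℕ) : ℝ) * √(N n : ℝ)))) atTop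
      (𝓝 0) := by
    refine Tendsto.const_div_atTop ?_ _
    refine Tendsto.const_mul_atTop two_pos (Tendsto.const_mul_atTop (by positivity) ?_)
    exact Real.tendsto_sqrt_atTop.comp (tendsto_natCast_atTop_atTop.comp hN)
  simpa using h.const_add (∑ i : Fin d, t i.castSucc ^ 2 / (2 * lam i.castSucc))

/-- Convergence of the characteristic functions of the rescaled magnetization. -/
lemma tendsto_charFun_rescaledMagnetization
    (hV : V ∈ Matrix.orthogonalGroup (Fin (d + 1)) ℝ)
    (hdec : A = Vᵀ * Matrix.diagonal lam * V)
    (hlam : ∀ i, 0 < lam i) (hlast : lam (Fin.last d) = ((d + 1 : ℕ) : ℝ))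
    (hsimple : ∀ i : Fin d, lam i.castSucc < ((d + 1 : ℕ) : ℝ))
    {N : ℕ → ℕ} (hN : Tendsto N atTop atTop) (hNpos : ∀ n, 0 < N n)
    (b : (n : ℕ) → Fin (N n) → Fin (d + 1))
    (hunif : ∀ i, Tendsto (fun n => √(N n : ℝ) *
      ((blockSize (b n) i : ℝ) / (N n : ℝ) - 1 / ((d + 1 : ℕ) : ℝ))) atTop (𝓝 0))
    (t : EuclideanSpace ℝ (Fin (d + 1))) :
    Tendsto (fun n => charFun ((isingMeasure (blockInteraction A (b n))).map
        (rescaledMagnetization V (b n))) t) atTop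
      (𝓝 (((Real.exp (-(1 / 2) * ∑ i : Fin d, t i.castSucc ^ 2 *
        (((d + 1 : ℕ) : ℝ) - lam i.castSucc)⁻¹) : ℝ) : ℂ) *
        quarticCharFun (quarticCoeff V) (t (Fin.last d)))) := by
  have h := tendsto_charFun_rescaledMagnetization_mul hV hdec hlam hlast hsimple hN hNpos b hunif t
  rw [integral_cexp_mul_limitDensity_div hV hlam hsimple] at h
  have h2 := (Complex.continuous_ofReal.tendsto _).comp
    ((Real.continuous_exp.tendsto _).comp (tendsto_sum_sq_div_scaledEigenvalue lam hN t))
  refine ((h.mul h2).congr fun n => ?_).trans_eq ?_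
  · simp only [Function.comp_apply]
    rw [mul_assoc, ← Complex.ofReal_mul, ← Real.exp_add, neg_add_cancel, Real.exp_zero,
      Complex.ofReal_one, mul_one]
  -- Subtraction of variances: `λ - λ²/k = λ(k - λ)/k`, whence `k/(λ(k - λ)) - 1/λ = 1/(k - λ)`.
  · rw [mul_right_comm, ← Complex.ofReal_mul, ← Real.exp_add]
    congr 5
    rw [← Finset.sum_neg_distrib, ← Finset.sum_add_distrib, Finset.mul_sum]
    refine Finset.sum_congr rfl fun i _ => ?_
    have h1 := (hlam i.castSucc).ne'
    have h3 : ((d + 1 : ℕ) : ℝ) - lam i.castSucc ≠ 0 := (sub_pos.2 (hsimple i)).ne'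
    have h4 : ((d + 1 : ℕ) : ℝ) ≠ 0 := by positivity
    have h5 : lam i.castSucc - lam i.castSucc ^ 2 / ((d + 1 : ℕ) : ℝ) =
        lam i.castSucc * (((d + 1 : ℕ) : ℝ) - lam i.castSucc) / ((d + 1 : ℕ) : ℝ) := by
      field_simp
    rw [h5]
    generalize ((d + 1 : ℕ) : ℝ) = k at *
    field_simp
    ring

end limit

/-! ### Weak convergence -/

lemma tendstoInDistribution_of_tendsto_charFun {E : Type*} [NormedAddCommGroup E]
    [InnerProductSpace ℝ E] [FiniteDimensional ℝ E] [MeasurableSpace E] [BorelSpace E]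
    {Ω : ℕ → Type*} [∀ n, MeasurableSpace (Ω n)] {P : (n : ℕ) → Measure (Ω n)}
    [∀ n, IsProbabilityMeasure (P n)] {X : (n : ℕ) → Ω n → E} (hX : ∀ n, AEMeasurable (X n) (P n))
    {ν : Measure E} [IsProbabilityMeasure ν]
    (h : ∀ t, Tendsto (fun n => charFun ((P n).map (X n)) t) atTop (𝓝 (charFun ν t))) :
    TendstoInDistribution X atTop (id : E → E) P ν where
  forall_aemeasurable := hX
  aemeasurable_limit := aemeasurable_id
  tendsto := by
    refine ProbabilityMeasure.tendsto_of_tendsto_charFun fun t => ?_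
    simpa using h t

lemma charFun_withDensity_ofReal {E : Type*} [NormedAddCommGroup E] [InnerProductSpace ℝ E]
    [MeasurableSpace E] [BorelSpace E] (μ : Measure E) {f : E → ℝ} (hf : Measurable f)
    (hf0 : ∀ x, 0 ≤ f x) (t : E) :
    charFun (μ.withDensity fun x => ENNReal.ofReal (f x)) t =
      ∫ x, Complex.exp ((inner ℝ x t : ℝ) * Complex.I) * (f x : ℂ) ∂μ := by
  rw [charFun_apply, integral_withDensity_eq_integral_toReal_smul hf.ennreal_ofReal
    (Eventually.of_forall fun _ => ENNReal.ofReal_lt_top)]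
  congr 1 with x
  rw [ENNReal.toReal_ofReal (hf0 x), Complex.real_smul, mul_comm]

lemma exists_probabilityMeasure_eq_withDensity {E : Type*} [MeasurableSpace E]
    {μ : Measure E} {f : E → ℝ} (hf : Integrable f μ) (hf0 : ∀ x, 0 ≤ f x)
    (hpos : 0 < ∫ x, f x ∂μ) :
    ∃ ν : ProbabilityMeasure E,
      (ν : Measure E) = μ.withDensity fun x => ENNReal.ofReal ((∫ x, f x ∂μ)⁻¹ * f x) := by
  have hν : IsProbabilityMeasure
      (μ.withDensity fun x => ENNReal.ofReal ((∫ x, f x ∂μ)⁻¹ * f x)) := by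
    refine ⟨?_⟩
    rw [withDensity_apply _ MeasurableSet.univ, Measure.restrict_univ,
      ← ofReal_integral_eq_lintegral_ofReal (hf.const_mul _)
        (Eventually.of_forall fun x => mul_nonneg (inv_nonneg.2 hpos.le) (hf0 x)),
      integral_const_mul, inv_mul_cancel₀ hpos.ne', ENNReal.ofReal_one]
  exact ⟨⟨_, hν⟩, rfl⟩

lemma charFun_multivariateGaussian_diagonal {ι : Type*} [Fintype ι] [DecidableEq ι]
    {v : ι → ℝ} (hv : ∀ i, 0 ≤ v i) (t : EuclideanSpace ℝ ι) :
    charFun (multivariateGaussian 0 (Matrix.diagonal v)) t =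
      ((Real.exp (-(1 / 2) * ∑ i, t i ^ 2 * v i) : ℝ) : ℂ) := by
  rw [charFun_multivariateGaussian (Matrix.PosSemidef.diagonal hv), Complex.ofReal_exp]
  congr 1
  have : (t : ι → ℝ) ⬝ᵥ Matrix.diagonal v *ᵥ t = ∑ i, t i ^ 2 * v i := by
    rw [dotProduct]
    exact Finset.sum_congr rfl fun i _ => by rw [Matrix.mulVec_diagonal]; ring
  rw [this]
  simp
  ring

lemma charFun_multivariateGaussian_scaledSpectrum {d N : ℕ} {lam : Fin (d + 1) → ℝ}
    (hlam : ∀ i, 0 < lam i) (hN : 0 < N) (t : EuclideanSpace ℝ (Fin (d + 1))) :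
    charFun (multivariateGaussian 0 (scaledSpectrum lam N)⁻¹) t =
      ((Real.exp (-∑ i, t i ^ 2 / (2 * scaledEigenvalue lam N i)) : ℝ) : ℂ) := by
  have hc := scaledEigenvalue_pos hlam hN
  have hinv : (scaledSpectrum lam N)⁻¹ =
      Matrix.diagonal fun i => (scaledEigenvalue lam N i)⁻¹ := by
    rw [scaledSpectrum_eq]
    refine Matrix.inv_eq_right_inv ?_
    rw [Matrix.diagonal_mul_diagonal, ← Matrix.diagonal_one]
    congr 1 with i
    exact mul_inv_cancel₀ (hc i).ne'
  rw [hinv, charFun_multivariateGaussian_diagonal fun i => (inv_pos.2 (hc i)).le,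
    Finset.mul_sum, ← Finset.sum_neg_distrib]
  congr 3 with i
  have := (hc i).ne'
  field_simp

/-- Used for the marginals: `f` is a coordinate projection and `s` is `t` padded with zeros. -/
lemma charFun_map_comp_rescaledMagnetization {N d : ℕ} {E : Type*} [NormedAddCommGroup E]
    [InnerProductSpace ℝ E] [MeasurableSpace E] [BorelSpace E] [SecondCountableTopology E]
    (J : Matrix (Fin N) (Fin N) ℝ) (V : Matrix (Fin (d + 1)) (Fin (d + 1)) ℝ)
    (b : Fin N → Fin (d + 1)) (f : EuclideanSpace ℝ (Fin (d + 1)) → E) (t : E)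
    (s : EuclideanSpace ℝ (Fin (d + 1))) (h : ∀ x, inner ℝ (f x) t = inner ℝ x s) :
    charFun ((isingMeasure J).map fun σ => f (rescaledMagnetization V b σ)) t =
      charFun ((isingMeasure J).map (rescaledMagnetization V b)) s := by
  rw [charFun_apply, charFun_apply,
    integral_map (measurable_of_countable _).aemeasurable (by fun_prop),
    integral_map (measurable_of_countable _).aemeasurable (by fun_prop)]
  simp_rw [h]

end BlockIsing

end

/-! ### The three limit laws -/

open BlockIsing in
theorem theorem1p4
    -- `k = d + 1` blocks; the block interaction matrix and its orthogonal decomposition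
    (d : ℕ) (A V : Matrix (Fin (d + 1)) (Fin (d + 1)) ℝ) (lam : Fin (d + 1) → ℝ)
    (hA : A.PosDef)
    (hV : V ∈ Matrix.orthogonalGroup (Fin (d + 1)) ℝ)
    (hdec : A = Vᵀ * Matrix.diagonal lam * V)
    (hlast : lam (Fin.last d) = ((d + 1 : ℕ) : ℝ))
    (hsimple : ∀ i : Fin d, lam i.castSucc < ((d + 1 : ℕ) : ℝ))
    -- the system sizes and the blocks, of asymptotically equal sizes
    (N : ℕ → ℕ) (hN : StrictMono N) (hNpos : ∀ n, 0 < N n)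
    (b : (n : ℕ) → Fin (N n) → Fin (d + 1))
    (hunif : ∀ i, Tendsto (fun n => Real.sqrt (N n) *
      ((BlockIsing.blockSize (b n) i : ℝ) / (N n : ℝ) - 1 / ((d + 1 : ℕ) : ℝ))) atTop (𝓝 0))
    -- the random variables
    {Ω : ℕ → Type*} [∀ n, MeasurableSpace (Ω n)]
    (P : (n : ℕ) → Measure (Ω n)) [∀ n, IsProbabilityMeasure (P n)]
    (X : (n : ℕ) → Ω n → (Fin (N n) → ℤˣ))
    (Y : (n : ℕ) → Ω n → EuclideanSpace ℝ (Fin (d + 1)))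
    (hX : ∀ n, HasLaw (X n)
      (BlockIsing.isingMeasure (BlockIsing.blockInteraction A (b n))) (P n))
    (hY : ∀ n, HasLaw (Y n)
      (multivariateGaussian 0 (BlockIsing.scaledSpectrum lam (N n))⁻¹) (P n))
    (hXY : ∀ n, IndepFun (X n) (Y n) (P n)) :
    -- the convolved vector
    (∃ Z : ℝ, 0 < Z ∧ ∃ ν : ProbabilityMeasure (EuclideanSpace ℝ (Fin (d + 1))),
      (ν : Measure (EuclideanSpace ℝ (Fin (d + 1)))) = volume.withDensity (fun x =>
        ENNReal.ofReal (Z⁻¹ * Real.exp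
          (-(1 / 2) * ∑ i : Fin d,
              (lam i.castSucc - lam i.castSucc ^ 2 / ((d + 1 : ℕ) : ℝ)) * x i.castSucc ^ 2
            - BlockIsing.quarticCoeff V * x (Fin.last d) ^ 4))) ∧
      TendstoInDistribution
        (fun n ω => BlockIsing.rescaledMagnetization V (b n) (X n ω) + Y n ω) atTop
        (id : EuclideanSpace ℝ (Fin (d + 1)) → EuclideanSpace ℝ (Fin (d + 1))) P ν) ∧
    -- the first `k - 1` coordinates
    TendstoInDistribution
      (fun n ω => (WithLp.toLp 2 (fun j : Fin d =>
        BlockIsing.rescaledMagnetization V (b n) (X n ω) j.castSucc) :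
          EuclideanSpace ℝ (Fin d))) atTop
      (id : EuclideanSpace ℝ (Fin d) → EuclideanSpace ℝ (Fin d)) P
      (multivariateGaussian 0
        (Matrix.diagonal fun j : Fin d => (((d + 1 : ℕ) : ℝ) - lam j.castSucc)⁻¹)) ∧
    -- the last coordinate
    (∃ Z : ℝ, 0 < Z ∧ ∃ ν : ProbabilityMeasure ℝ,
      (ν : Measure ℝ) = volume.withDensity (fun x =>
        ENNReal.ofReal (Z⁻¹ * Real.exp (-BlockIsing.quarticCoeff V * x ^ 4))) ∧
      TendstoInDistribution
        (fun n ω => BlockIsing.rescaledMagnetization V (b n) (X n ω) (Fin.last d)) atTop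
        (id : ℝ → ℝ) P ν) := by
  -- The eigenvalue `λ_i` is the quadratic form of `A` at row `i` of `V`, a nonzero vector.
  have hlam : ∀ i, 0 < lam i := by
    have hV' : V * Vᵀ = 1 := (Matrix.mem_orthogonalGroup_iff _ _).1 hV
    have hdiag : V * A * Vᵀ = Matrix.diagonal lam := by
      rw [hdec, mul_assoc, mul_assoc, hV', mul_one, ← mul_assoc, hV', one_mul]
    intro i
    have hne : V i ≠ 0 := by
      intro h0
      have h1 := congrFun (congrFun hV' i) i
      rw [Matrix.mul_apply, Matrix.one_apply_eq] at h1
      simp [h0] at h1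
    have h1 := congrFun (congrFun hdiag i) i
    rw [Matrix.diagonal_apply_eq] at h1
    have h2 := hA.dotProduct_mulVec_pos hne
    rw [← h1, mul_assoc]
    rw [star_trivial] at h2
    exact h2
  have hNt : Tendsto N atTop atTop := hN.tendsto_atTop
  have hmeas : ∀ n {E : Type} [MeasurableSpace E] (f : (Fin (N n) → ℤˣ) → E),
      AEMeasurable (fun ω => f (X n ω)) (P n) := fun n E _ f =>
    (measurable_of_countable f).comp_aemeasurable (hX n).aemeasurable
  have hmap : ∀ n {E : Type} [MeasurableSpace E] (f : (Fin (N n) → ℤˣ) → E),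
      (P n).map (fun ω => f (X n ω)) =
        (isingMeasure (blockInteraction A (b n))).map f := fun n E _ f => by
    rw [← (hX n).map_eq, AEMeasurable.map_map_of_aemeasurable
      (measurable_of_countable f).aemeasurable (hX n).aemeasurable]
    rfl
  have hcf := tendsto_charFun_rescaledMagnetization hV hdec hlam hlast hsimple hNt hNpos b hunif
  have hq := quarticCoeff_pos hV
  refine ⟨⟨∫ x, limitDensity V lam x, integral_limitDensity_pos hV hlam hsimple, ?_⟩, ?_,
    ⟨∫ y : ℝ, Real.exp (-quarticCoeff V * y ^ 4),
      integral_exp_pos (integrable_exp_neg_mul_pow_four hq), ?_⟩⟩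
  -- The densities were integrated over plain functions; the measure-preserving identification
  -- carries the results to Euclidean space.
  · have hpres := PiLp.volume_preserving_ofLp (Fin (d + 1))
    have hemb : MeasurableEmbedding (WithLp.ofLp : EuclideanSpace ℝ (Fin (d + 1)) → _) :=
      (MeasurableEquiv.toLp 2 (Fin (d + 1) → ℝ)).symm.measurableEmbedding
    have hint : ∫ x : EuclideanSpace ℝ (Fin (d + 1)), limitDensity V lam x.ofLp =
        ∫ x, limitDensity V lam x := hpres.integral_comp hemb _
    obtain ⟨ν, hν⟩ := exists_probabilityMeasure_eq_withDensity
      (μ := (volume : Measure (EuclideanSpace ℝ (Fin (d + 1)))))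
      (f := fun x => limitDensity V lam x.ofLp)
      ((hpres.integrable_comp_emb hemb).2 (integrable_limitDensity hV hlam hsimple))
      (fun x => (Real.exp_pos _).le) (by
        rw [hint]; exact integral_limitDensity_pos hV hlam hsimple)
    rw [hint] at hν
    refine ⟨ν, hν, ?_⟩
    refine tendstoInDistribution_of_tendsto_charFun
      (fun n => (hmeas n _).add (hY n).aemeasurable) fun t => ?_
    have h := tendsto_charFun_rescaledMagnetization_mul hV hdec hlam hlast hsimple hNt hNpos b
      hunif t
    convert h using 2 with n
    · have hind : IndepFun (fun ω => rescaledMagnetization V (b n) (X n ω)) (Y n) (P n) :=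
        (hXY n).comp (measurable_of_countable (rescaledMagnetization V (b n))) measurable_id
      rw [hind.charFun_map_add_eq_mul (hmeas n _) (hY n).aemeasurable, Pi.mul_apply,
        (hY n).map_eq, charFun_multivariateGaussian_scaledSpectrum hlam (hNpos n), hmap]
    · have hm : Measurable fun x : EuclideanSpace ℝ (Fin (d + 1)) =>
          (∫ x, limitDensity V lam x)⁻¹ * limitDensity V lam x.ofLp :=
        (continuous_limitDensity.measurable.comp hpres.measurable).const_mul _
      rw [hν, charFun_withDensity_ofReal _ hm (fun x => mul_nonneg (inv_nonneg.2
          (integral_limitDensity_pos hV hlam hsimple).le) (Real.exp_pos _).le),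
        ← hpres.integral_comp hemb fun x : Fin (d + 1) → ℝ =>
          Complex.exp ((∑ i, t i * x i : ℝ) * Complex.I) * (limitDensity V lam x : ℂ),
        div_eq_inv_mul, ← integral_const_mul]
      congr 1 with x
      simp only [PiLp.inner_apply, RCLike.inner_apply, conj_trivial]
      push_cast
      ring
  · have hv : ∀ j : Fin d, 0 ≤ (((d + 1 : ℕ) : ℝ) - lam j.castSucc)⁻¹ := fun j =>
      inv_nonneg.2 (sub_nonneg.2 (hsimple j).le)
    refine tendstoInDistribution_of_tendsto_charFun (fun n => hmeas n fun σ =>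
      (WithLp.toLp 2 (fun j : Fin d => rescaledMagnetization V (b n) σ j.castSucc) :
        EuclideanSpace ℝ (Fin d))) fun t => ?_
    -- A zero in the critical slot reduces the quartic factor to `1`.
    have h := hcf (WithLp.toLp 2 (Fin.snoc (α := fun _ => ℝ) t 0))
    simp only [Fin.snoc_castSucc, Fin.snoc_last, quarticCharFun_zero hq, mul_one] at h
    rw [charFun_multivariateGaussian_diagonal hv]
    refine h.congr fun n => ?_
    rw [hmap n fun σ => (WithLp.toLp 2 (fun j : Fin d =>
        rescaledMagnetization V (b n) σ j.castSucc) : EuclideanSpace ℝ (Fin d))]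
    refine (charFun_map_comp_rescaledMagnetization _ V (b n)
      (fun w => (WithLp.toLp 2 (fun j : Fin d => w j.castSucc) : EuclideanSpace ℝ (Fin d))) _ _
      fun w => ?_).symm
    simp [PiLp.inner_apply, Fin.sum_univ_castSucc]
  · obtain ⟨ν, hν⟩ := exists_probabilityMeasure_eq_withDensity
      (integrable_exp_neg_mul_pow_four hq) (fun x => (Real.exp_pos _).le)
      (integral_exp_pos (integrable_exp_neg_mul_pow_four hq))
    refine ⟨ν, hν, ?_⟩
    refine tendstoInDistribution_of_tendsto_charFun (fun n => hmeas n fun σ =>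
      rescaledMagnetization V (b n) σ (Fin.last d)) fun s => ?_
    -- Zeros in the other slots reduce the Gaussian factor to `1`.
    have h := hcf (WithLp.toLp 2 (Fin.snoc (α := fun _ => ℝ) 0 s))
    simp only [Fin.snoc_castSucc, Fin.snoc_last, Pi.zero_apply, ne_eq, OfNat.ofNat_ne_zero,
      not_false_eq_true, zero_pow, zero_mul, Finset.sum_const_zero, mul_zero, Real.exp_zero,
      Complex.ofReal_one, one_mul] at h
    convert h using 2 with n
    · rw [hmap n fun σ => rescaledMagnetization V (b n) σ (Fin.last d)]
      refine charFun_map_comp_rescaledMagnetization _ V (b n) (fun w => w (Fin.last d)) _ _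
        fun w => ?_
      simp [PiLp.inner_apply, Fin.sum_univ_castSucc]
    · rw [hν, charFun_withDensity_ofReal _ (by fun_prop) (fun x => mul_nonneg (inv_nonneg.2
          (integral_exp_pos (integrable_exp_neg_mul_pow_four hq)).le) (Real.exp_pos _).le),
        quarticCharFun, div_eq_inv_mul, ← integral_const_mul]
      congr 1 with x
      simp only [RCLike.inner_apply, conj_trivial]
      push_cast
      ring
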